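/- **Setting.** FileDAG is run by $N=3f+1$ miners, at most $f$ of them Byzantine. A vertex of its ledger has a round number, a proposer, at most one transaction, a list of proofs of storage, and edges. The transactions are: create (a new original file, given by its content identifier), update of a version $u$ (given by the identifier of the increment $\mathrm{diff}(A,B)$ from the file $A$ of $u$ to the new file $B$), merge of two versions, and fork of a version into several copies. The versions that a transaction derives from are the endpoints of its lower-layer edges. $\mathsf{Retrieve}(v)$ runs a breadth-first search from $v$ along the lower-layer edges, back to original files, and returns the visited versions in reverse order; $\mathsf{Recover}$ downloads the original file and the increments in this list and patches the increments onto the original file in this order. (The file of a merged version is what the increments of both branches give in this order.) The following is assumed: distinct data have distinct content identifiers; $\mathrm{patch}(A,\mathrm{diff}(A,B))=B$ for all files $A,B$; and the proof of storage is sound, i.e. if a miner can output, at its round $r$, a valid proof of storage (by this miner, for round $r$) for an identifier $c$, then it can then output a copy of data with identifier $c$. Let $W$ be any set of rounds (the proving period). An honest node *claims* that $v$ is available if, on the ledger it has committed, $\mathsf{Retrieve}(v)$ succeeds and, for every fragment in the returned list, some committed vertex of a round in $W$ contains a valid proof of storage by its proposer for this fragment. Version $v$ *is available* if $\mathsf{Retrieve}(v)$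 succeeds on the ledger of all vertices that honest nodes ever commit, every fragment in the list can be downloaded from some miner at a round in $W$, and, if $v$ is a version of a file $B$, then $\mathsf{Recover}$ outputs $B$ from whatever is downloaded under the identifiers of the fragments. *Consistency of multi-version DSN* means that for all $W$ and $v$: (a) if an honest node ever claims that $v$ is available, then $v$ is available; (b) if an honest node ever claims that $v$ is available, then every honest node claims the same from some time on. **Theorem.** 1. FileDAG meets consistency of multi-version DSN whenever its ledger realizes Byzantine atomic broadcast, i.e. honest nodes only append to their committed logs, and agreement, integrity, validity and total order hold. 2. Let FileDAG use the two-layer ledger that is built by DAG-Rider: each honest node proposes one vertex per round, with lower-layer edges to committed vertices, strong edges to at least $2f+1$ vertices of the previous round, and weak edges to all older vertices that are not yet reachable; a vertex enters a local DAG only after all vertices that it refers to; and nodes commit the causal histories (along the edges of both layers) of the leaders of waves of four rounds by the rule of DAG-Rider, where the leaders are drawn by a uniform independent common coin, and the coin of a wave is revealed when the first honest node completes the wave. Then for every adversary, which controls the Byzantine nodes, the asynchronous network, the scheduling and the clients and knows all past states and all revealed coins, almost surely: if reliable broadcast delivers (every vertex that is broadcast by an honest node, or delivered to one honest node, is delivered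 to every honest node) and no honest node stalls, then FileDAG meets consistency of multi-version DSN. -/

import Mathlib

namespace FileDAG

/-! ### Data, versions and transactions -/

/-- Files, increments, content identifiers and proofs of storage are bit strings. -/
abbrev Bits := List Bool

/-- The algorithms that FileDAG is built on, for a network of `N` miners. -/
structure Primitives (N : ℕ) where
  /-- the content identifier (fingerprint) of a piece of data -/
  cid : Bits → Bits
  /-- `diff A B` is the increment from `A` to `B` -/
  diff : Bits → Bits → Bits
  /-- `patch A D` applies the increment `D` to `A` -/
  patch : Bits → Bits → Bits
  /-- `verify m r c π`: the string `π` is a valid proof of storage, by miner `m` in round `r`,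
  of the data with identifier `c` -/
  verify : Fin N → ℕ → Bits → Bits → Bool

/-- Diff and patch are correct: patching the increment from `A` to `B` onto `A` yields `B`. -/
def Primitives.DiffPatchCorrect {N : ℕ} (P : Primitives N) : Prop :=
  ∀ A B : Bits, P.patch A (P.diff A B) = B

/-- The identity of a ledger vertex: its round and the miner that proposes it. -/
abbrev VertexId (N : ℕ) := ℕ × Fin N

/-- A file version: the vertex whose transaction creates it, and a number that tells apart
the several versions which one fork transaction creates. -/
structure Version (N : ℕ) where
  vertex : VertexId N
  index : ℕ

/-- The four types of transactions. -/
inductive Tx (N : ℕ) where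
  /-- a new original file with identifier `c` -/
  | create (c : Bits)
  /-- a new version that follows `v` by the increment with identifier `c` -/
  | update (v : Version N) (c : Bits)
  /-- the combination of two branches -/
  | merge (v v' : Version N)
  /-- `k` new versions, each a copy of `v` -/
  | fork (v : Version N) (k : ℕ)

namespace Tx
variable {N : ℕ}

/-- The versions that a transaction derives from. -/
def previous : Tx N → List (Version N)
  | create _ => []
  | update v _ => [v]
  | merge v v' => [v, v']
  | fork v _ => [v]

/-- The indices of the versions that a transaction creates. -/
def Creates : Tx N → ℕ → Prop
  | fork _ k, j => j < k
  | _, j => j = 0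

/-- The identifiers of the data (an original file or an increment) that a transaction adds. -/
def fragments : Tx N → List Bits
  | create c => [c]
  | update _ c => [c]
  | _ => []

end Tx

/-- The content of a vertex: at most one transaction, and proofs of storage `(c, π)` made by the
proposing miner, where `c` identifies the stored data. -/
structure Block (N : ℕ) where
  tx : Option (Tx N)
  proofs : List (Bits × Bits)

/-- A vertex of the ledger. The upper layer consists of the strong edges, to vertices of the
preceding round (given by their proposers), and the weak edges, to vertices of older rounds. -/
structure Vertex (N : ℕ) where
  round : ℕ
  source : Fin N
  block : Block N
  strong : Finset (Fin N)
  weak : Finset (VertexId N)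

namespace Vertex
variable {N : ℕ}

def id (v : Vertex N) : VertexId N := (v.round, v.source)

/-- The endpoints of the strong edges. -/
def strongIds (v : Vertex N) : Finset (VertexId N) := v.strong.image fun s => (v.round - 1, s)

end Vertex

/-- The lower-layer edges of a block: to the vertices of the versions it derives from. -/
def Block.lowerIds {N : ℕ} (b : Block N) : Finset (VertexId N) :=
  (b.tx.elim [] fun tx => tx.previous.map Version.vertex).toFinset

/-- The endpoints of all edges, of both layers. -/
def Vertex.refs {N : ℕ} (v : Vertex N) : Finset (VertexId N) :=
  v.strongIds ∪ v.weak ∪ v.block.lowerIds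

/-! ### File recovery -/

section Recovery
variable {N : ℕ}

/-- The ledger `L` (a set of vertices) records `v` as a version created by `tx`. -/
def Records (L : Set (Vertex N)) (v : Version N) (tx : Tx N) : Prop :=
  ∃ u ∈ L, u.id = v.vertex ∧ u.block.tx = some tx ∧ tx.Creates v.index

/-- `BFS L Q out`: the search along the lower-layer edges that starts with queue `Q` terminates
and visits versions whose transactions are, in this order, `out`. Original files have no
previous versions. -/
inductive BFS (L : Set (Vertex N)) : List (Version N) → List (Tx N) → Prop
  | nil : BFS L [] []
  | step {v : Version N} {Q : List (Version N)} {tx : Tx N} {out : List (Tx N)} :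
      Records L v tx → BFS L (Q ++ tx.previous) out → BFS L (v :: Q) (tx :: out)

/-- `Retrieve(v)`, run on the ledger `L`, returns `vs`. -/
def Retrieves (L : Set (Vertex N)) (v : Version N) (vs : List (Tx N)) : Prop :=
  BFS L [v] vs.reverse

/-- The identifiers of all fragments to be downloaded. -/
def fragmentsOf (vs : List (Tx N)) : List Bits := vs.flatMap Tx.fragments

/-- One iteration of `Recover`: increments are patched, all other versions are skipped. -/
def applyIncrement (P : Primitives N) (data : Bits → Bits) (file : Bits) : Tx N → Bits
  | .update _ c => P.patch file (data c)
  | _ => file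

/-- `Recover(versions)`, where `data` gives the downloaded fragment for each identifier. -/
def recover (P : Primitives N) (data : Bits → Bits) : List (Tx N) → Option Bits
  | .create c :: vs => some (vs.foldl (applyIncrement P data) (data c))
  | _ => none

/-- `Represents P L v B`: on the ledger `L`, `v` is a version of a file, with content `B`. An
update to content `B` is recorded by the identifier of the increment from the previous content.
A fork copies. A merge adds no information: its content is given by the increments of both
branches. -/
inductive Represents (P : Primitives N) (L : Set (Vertex N)) : Version N → Bits → Prop
  | create {v : Version N} {B : Bits} :
      Records L v (.create (P.cid B)) → Represents P L v B
  | update {v u : Version N} {A B : Bits} :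
      Records L v (.update u (P.cid (P.diff A B))) → Represents P L u A → Represents P L v B
  | fork {v u : Version N} {k : ℕ} {A : Bits} :
      Records L v (.fork u k) → Represents P L u A → Represents P L v A
  | merge {v u u' : Version N} {A A' B : Bits} {vs : List (Tx N)} {data : Bits → Bits} :
      Records L v (.merge u u') → Represents P L u A → Represents P L u' A' →
      Retrieves L v vs → (∀ c ∈ fragmentsOf vs, P.cid (data c) = c) →
      recover P data vs = some B → Represents P L v B

/-! ### Proofs of storage and consistency -/

/-- Soundness of the proof of storage. Here `able m r` is the set of strings that miner `m` is
able to output when it proposes its vertex of round `r`. A miner that can output a valid proof for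
an identifier can output a copy of data with this identifier. -/
def PoSSound (P : Primitives N) (able : Fin N → ℕ → Set Bits) : Prop :=
  ∀ (m : Fin N) (r : ℕ) (c π : Bits), π ∈ able m r → P.verify m r c π = true →
    ∃ d ∈ able m r, P.cid d = c

/-- The proofs in the vertices of `L` were output by the miners that proposed these vertices. -/
def ProofsOutput (L : Set (Vertex N)) (able : Fin N → ℕ → Set Bits) : Prop :=
  ∀ u ∈ L, ∀ x ∈ u.block.proofs, x.2 ∈ able u.source u.round

/-- An honest node whose committed ledger is `L` claims, by verifying the proofs of storage of the
rounds in `W`, that version `v` is available: retrieval succeeds, and every fragment has a valid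
proof, committed in a vertex of the miner that made it. -/
def Claims (P : Primitives N) (W : Set ℕ) (L : Set (Vertex N)) (v : Version N) : Prop :=
  ∃ vs, Retrieves L v vs ∧ ∀ c ∈ fragmentsOf vs, ∃ u ∈ L, u.round ∈ W ∧
    ∃ π, (c, π) ∈ u.block.proofs ∧ P.verify u.source u.round c π = true

/-- `d` can be downloaded under the identifier `c`, from some miner in a round of `W`. -/
def Downloadable (P : Primitives N) (able : Fin N → ℕ → Set Bits) (W : Set ℕ) (c d : Bits) :
    Prop :=
  P.cid d = c ∧ ∃ m, ∃ r ∈ W, d ∈ able m r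

/-- Version `v` of the ledger `G` is really available (in the rounds of `W`): the list of its
fragments exists and they all can be downloaded from miners, and whatever is downloaded under their
identifiers, the recovery outputs the file of version `v`. -/
def Available (P : Primitives N) (able : Fin N → ℕ → Set Bits) (W : Set ℕ) (G : Set (Vertex N))
    (v : Version N) : Prop :=
  (∃ vs, Retrieves G v vs ∧ ∀ c ∈ fragmentsOf vs, ∃ d, Downloadable P able W c d) ∧
  ∀ vs data B, Retrieves G v vs → (∀ c ∈ fragmentsOf vs, Downloadable P able W c (data c)) →
    Represents P G v B → recover P data vs = some B

/-- What node `p` has committed by time `t`. -/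
def view (log : Fin N → ℕ → List (Vertex N)) (p : Fin N) (t : ℕ) : Set (Vertex N) :=
  {u | u ∈ log p t}

/-- The ledger: all that honest nodes ever commit. -/
def ledger (H : Finset (Fin N)) (log : Fin N → ℕ → List (Vertex N)) : Set (Vertex N) :=
  {u | ∃ p ∈ H, ∃ t, u ∈ log p t}

/-- Consistency of a multi-version DSN, for honest nodes `H` with committed logs `log`. Nodes
commit asynchronously, so the other honest nodes claim the same from some time on. -/
def Consistent (P : Primitives N) (able : Fin N → ℕ → Set Bits) (H : Finset (Fin N))
    (log : Fin N → ℕ → List (Vertex N)) : Prop :=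
  ∀ (W : Set ℕ) (v : Version N), ∀ p ∈ H, ∀ t, Claims P W (view log p t) v →
    Available P able W (ledger H log) v ∧
    ∀ q ∈ H, ∃ t₀, ∀ t' ≥ t₀, Claims P W (view log q t') v

/-- FileDAG on the given logs meets consistency, provided that its proof of storage is sound. -/
def MeetsConsistency (P : Primitives N) (H : Finset (Fin N))
    (log : Fin N → ℕ → List (Vertex N)) : Prop :=
  ∀ able : Fin N → ℕ → Set Bits, ProofsOutput (ledger H log) able → PoSSound P able →
    Consistent P able H log

/-- The logs realize Byzantine atomic broadcast among the honest nodes `H`; `proposed p i` says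
that node `p` proposes vertex `i`. -/
structure ByzantineAtomicBroadcast (H : Finset (Fin N)) (proposed : Fin N → Vertex N → Prop)
    (log : Fin N → ℕ → List (Vertex N)) : Prop where
  append_only : ∀ p ∈ H, ∀ t t', t ≤ t' → log p t <+: log p t'
  agreement : ∀ p ∈ H, ∀ t, ∀ i ∈ log p t, ∀ q ∈ H, ∃ t', i ∈ log q t'
  integrity : ∀ p ∈ H, ∀ t, (log p t).Pairwise fun i j => i.id ≠ j.id
  validity : ∀ p ∈ H, ∀ i, proposed p i → ∀ q ∈ H, ∃ t, i ∈ log q t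
  total_order : ∀ p ∈ H, ∀ t i j, [i, j].Sublist (log p t) →
    ∀ q ∈ H, ∀ t', j ∈ log q t' → [i, j].Sublist (log q t')

end Recovery

/-! ### The two-layer ledger, built by DAG-Rider with `3 f + 1` nodes

The nodes `H` are honest. Vertices are disseminated by reliable broadcast, and the leader of each
wave of four rounds is drawn by a common coin. -/

section Ledger
variable {f : ℕ}

abbrev Node (f : ℕ) := Fin (3 * f + 1)

/-- A local DAG (without genesis), or any other table of vertices. -/
abbrev Table (f : ℕ) := VertexId (3 * f + 1) → Option (Vertex (3 * f + 1))

/-- Round 0 consists of `2 f + 1` genesis vertices, which every DAG contains. -/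
def InDag (D : Table f) (a : VertexId (3 * f + 1)) : Prop :=
  (a.1 = 0 ∧ a.2.val < 2 * f + 1) ∨ (D a).isSome

open Classical in
/-- The proposers of the vertices of round `r` in a DAG. -/
noncomputable def sources (D : Table f) (r : ℕ) : Finset (Node f) :=
  Finset.univ.filter fun s => InDag D (r, s)

def StrongPath (D : Table f) : VertexId (3 * f + 1) → VertexId (3 * f + 1) → Prop :=
  Relation.ReflTransGen fun a b => ∃ v, D a = some v ∧ b ∈ v.strongIds

/-- Paths use the edges of both layers. -/
def Path (D : Table f) : VertexId (3 * f + 1) → VertexId (3 * f + 1) → Prop :=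
  Relation.ReflTransGen fun a b => ∃ v, D a = some v ∧ b ∈ v.refs

/-- The checks on a vertex that is received. -/
def WellFormed (v : Vertex (3 * f + 1)) : Prop :=
  1 ≤ v.round ∧ 2 * f + 1 ≤ v.strong.card ∧ (∀ b ∈ v.weak, 1 ≤ b.1 ∧ b.1 + 1 < v.round) ∧
    ∀ b ∈ v.block.lowerIds, 1 ≤ b.1 ∧ b.1 < v.round

/-- The state of an honest node. -/
structure LocalState (f : ℕ) where
  round : ℕ
  /-- vertices received but not yet in the DAG -/
  buffer : Table f
  dag : Table f
  /-- the last wave whose leader was committed directly -/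
  decidedWave : ℕ
  /-- the committed vertices, in order -/
  log : List (Vertex (3 * f + 1))

/-- The state of the system. The table `sent` is the reliable broadcast: it holds the only vertex
of each proposer in each round that can be delivered. -/
structure GlobalState (f : ℕ) where
  sent : Table f
  node : Node f → LocalState f

/-- The state in which node `p` has local state `S`. -/
def GlobalState.setNode (G : GlobalState f) (p : Node f) (S : LocalState f) : GlobalState f :=
  { G with node := Function.update G.node p S }

def initialState (f : ℕ) : GlobalState f where
  sent := fun _ => none
  node := fun _ => ⟨0, fun _ => none, fun _ => none, 0, []⟩

/-- The outcomes of the coin: wave `w ≥ 1` has leader `ω w`. -/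
abbrev Coins (f : ℕ) := ℕ → Node f

/-- The coin is uniform, and independent for different waves. -/
noncomputable def coinMeasure (f : ℕ) : MeasureTheory.Measure (Coins f) :=
  MeasureTheory.Measure.infinitePi fun _ => (PMF.uniformOfFintype (Node f)).toMeasure

/-- The leader vertex of wave `w`, in the first of its rounds `4 w - 3, …, 4 w`. -/
def leader (ω : Coins f) (w : ℕ) : VertexId (3 * f + 1) := (4 * w - 3, ω w)

open Classical in
/-- The leaders of the waves `d + k, …, d + 1` that are committed along with `a`, latest first. -/
noncomputable def earlierLeaders (ω : Coins f) (D : Table f) (d : ℕ) :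
    ℕ → VertexId (3 * f + 1) → List (VertexId (3 * f + 1))
  | 0, _ => []
  | k + 1, a =>
    if InDag D (leader ω (d + k + 1)) ∧ StrongPath D a (leader ω (d + k + 1)) then
      leader ω (d + k + 1) :: earlierLeaders ω D d k (leader ω (d + k + 1))
    else earlierLeaders ω D d k a

open Classical in
/-- Commit the causal history of a leader `a`, as far as new, ordered by round and proposer. -/
noncomputable def commitHistory (D : Table f) (log : List (Vertex (3 * f + 1)))
    (a : VertexId (3 * f + 1)) : List (Vertex (3 * f + 1)) :=
  log ++ ((((List.range (a.1 + 1)).flatMap fun r =>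
    (List.finRange (3 * f + 1)).map fun s => (r, s)).filterMap D).filter
      fun v => Path D a v.id ∧ v ∉ log)

open Classical in
/-- What a node does when it completes wave `w`. -/
noncomputable def completeWave (ω : Coins f) (w : ℕ) (S : LocalState f) : LocalState f :=
  if InDag S.dag (leader ω w) ∧
      2 * f + 1 ≤
        ((sources S.dag (4 * w)).filter fun s => StrongPath S.dag (4 * w, s) (leader ω w)).card
  then
    { S with
      decidedWave := w
      log := (leader ω w :: earlierLeaders ω S.dag S.decidedWave (w - 1 - S.decidedWave)
        (leader ω w)).reverse.foldl (commitHistory S.dag) S.log }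
  else S

open Classical in
/-- The weak edges of a new vertex of round `r` whose other edges are `base`: for the rounds
`r - 2, …, 1`, to all vertices which are not reachable yet. -/
noncomputable def weakEdges (D : Table f) (r : ℕ) (base : Finset (VertexId (3 * f + 1))) :
    Finset (VertexId (3 * f + 1)) :=
  (List.range' 1 (r - 2)).reverse.foldl (fun E k =>
    E ∪ ((sources D k).filter fun s => ¬ ∃ a ∈ base ∪ E, Path D a (k, s)).image fun s => (k, s)) ∅

open Classical in
/-- An honest node includes a transaction only if it has committed the versions it derives from. -/
noncomputable def checkedBlock (log : List (Vertex (3 * f + 1))) (b : Block (3 * f + 1)) :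
    Block (3 * f + 1) :=
  if ∀ tx ∈ b.tx, ∀ v ∈ tx.previous, ∃ tx', Records {u | u ∈ log} v tx' then b
  else { b with tx := none }

/-- The vertex of round `r` that an honest node `p` proposes, with lower-layer edges given by the
block. -/
noncomputable def newVertex (p : Node f) (r : ℕ) (b : Block (3 * f + 1)) (S : LocalState f) :
    Vertex (3 * f + 1) where
  round := r
  source := p
  block := checkedBlock S.log b
  strong := sources S.dag (r - 1)
  weak := weakEdges S.dag r
    ((sources S.dag (r - 1)).image (fun s => (r - 1, s)) ∪ (checkedBlock S.log b).lowerIds)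

/-- The adversary chooses in each step one of these actions. -/
inductive Action (f : ℕ) where
  /-- a Byzantine node broadcasts a vertex -/
  | broadcast (v : Vertex (3 * f + 1))
  /-- an honest node receives the vertex with this identity -/
  | deliver (p : Node f) (a : VertexId (3 * f + 1))
  /-- an honest node moves a vertex from its buffer to its DAG -/
  | accept (p : Node f) (a : VertexId (3 * f + 1))
  /-- an honest node enters its next round and proposes a vertex with this content -/
  | advance (p : Node f) (b : Block (3 * f + 1))

/-- A buffered vertex `v` may enter the DAG. -/
def Includable (S : LocalState f) (v : Vertex (3 * f + 1)) : Prop :=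
  v.round ≤ S.round ∧ ∀ b ∈ v.refs, InDag S.dag b

/-- A node may enter its next round. -/
def RoundComplete (S : LocalState f) : Prop :=
  2 * f + 1 ≤ (sources S.dag S.round).card

open Classical in
/-- The effect of an action; actions that are not permitted have no effect. -/
noncomputable def apply (H : Finset (Node f)) (ω : Coins f) (G : GlobalState f) :
    Action f → GlobalState f
  | .broadcast v =>
    if v.source ∉ H ∧ G.sent v.id = none then
      { G with sent := Function.update G.sent v.id (some v) }
    else G
  | .deliver p a =>
    let S := G.node p
    if p ∈ H ∧ S.buffer a = none ∧ S.dag a = none ∧ ∃ v, G.sent a = some v ∧ WellFormed v then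
      G.setNode p { S with buffer := Function.update S.buffer a (G.sent a) }
    else G
  | .accept p a =>
    let S := G.node p
    if p ∈ H ∧ ∃ v, S.buffer a = some v ∧ Includable S v then
      G.setNode p { S with
        buffer := Function.update S.buffer a none
        dag := Function.update S.dag a (S.buffer a) }
    else G
  | .advance p b =>
    let S := G.node p
    if p ∈ H ∧ RoundComplete S then
      let S' := if 0 < S.round ∧ S.round % 4 = 0 then completeWave ω (S.round / 4) S else S
      let v := newVertex p (S.round + 1) b S'
      { G.setNode p { S' with round := S.round + 1 } with
        sent := Function.update G.sent v.id (some v) }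
    else G

open Classical in
/-- The coin of a wave is revealed when the first honest node has completed the wave. -/
noncomputable def revealed (H : Finset (Node f)) (ω : Coins f) (G : GlobalState f) (w : ℕ) :
    Option (Node f) :=
  if ∃ p ∈ H, 4 * w < (G.node p).round then some (ω w) else none

/-- A strategy of the adversary: it controls the Byzantine nodes, the network, the scheduling and
the inputs of the clients, and sees all past states (the latest first) and the revealed coins. -/
abbrev Adversary (f : ℕ) := List (GlobalState f) → (ℕ → Option (Node f)) → Action f

/-- The state at time `t`, together with the list of all earlier states, latest first. -/
noncomputable def history (H : Finset (Node f)) (adv : Adversary f) (ω : Coins f) :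
    ℕ → GlobalState f × List (GlobalState f)
  | 0 => (initialState f, [])
  | t + 1 =>
    let h := history H adv ω t
    (apply H ω h.1 (adv (h.1 :: h.2) (revealed H ω h.1)), h.1 :: h.2)

/-- The run of the system: its state at each time. -/
noncomputable def run (H : Finset (Node f)) (adv : Adversary f) (ω : Coins f) (t : ℕ) :
    GlobalState f :=
  (history H adv ω t).1

/-- The vertex with identity `a` has been delivered to a node. -/
def Delivered (S : LocalState f) (a : VertexId (3 * f + 1)) : Prop :=
  (S.buffer a).isSome ∨ (S.dag a).isSome

/-- The assumptions of the asynchronous model, on a run `G`: reliable broadcast delivers, and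
honest nodes do not stall. -/
structure Fair (H : Finset (Node f)) (G : ℕ → GlobalState f) : Prop where
  /-- what an honest node broadcasts is delivered to all honest nodes -/
  broadcast_validity : ∀ p ∈ H, ∀ r t, ((G t).sent (r, p)).isSome →
    ∀ q ∈ H, ∃ t', Delivered ((G t').node q) (r, p)
  /-- what is delivered to one honest node is delivered to all honest nodes -/
  broadcast_agreement : ∀ p ∈ H, ∀ a t, Delivered ((G t).node p) a →
    ∀ q ∈ H, ∃ t', Delivered ((G t').node q) a
  accept_fair : ∀ p ∈ H, ∀ a v t, ((G t).node p).buffer a = some v →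
    Includable ((G t).node p) v → ∃ t', (((G t').node p).dag a).isSome
  advance_fair : ∀ p ∈ H, ∀ t, RoundComplete ((G t).node p) →
    ∃ t', ((G t).node p).round < ((G t').node p).round

/-- The committed logs of a run. -/
def logOf (G : ℕ → GlobalState f) (p : Node f) (t : ℕ) : List (Vertex (3 * f + 1)) :=
  ((G t).node p).log

end Ledger

end FileDAG

open FileDAG

/-! Consistency follows from three properties of the logs: they only grow, what one honest node
commits is eventually committed by all, and no identity is committed with two contents
(`meetsConsistency_of_agreement`). A claim reads finitely many vertices, so it spreads to every
honest node. Unique identities make the search deterministic, and injective identifiers force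
downloaded data to be the original data, so `Represents.recover_eq` obtains the file by induction on
how the version was derived. Sound proofs of storage supply the downloads. Atomic broadcast gives
the three properties at once.

For DAG-Rider, growth and unique identities are invariants of every run, since all local DAGs are
parts of one table of broadcasts. For agreement, every committed vertex lies in the causal history
of a directly committed leader, say of wave `w`. By quorum intersection, every vertex of a later
wave has a strong path to this leader (`DirectCommit.strongPath`), so a node that directly commits
any later leader commits that vertex too.

It remains to find infinitely many waves whose leader every honest node commits directly. Double
counting yields in each wave a common core: `2 f + 1` vertices of its first round that are reached
from its whole last round (`SoundDag.exists_commonCore`, `CommonCore.strongPath`). A leader in the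
core is committed directly by every honest node. A core exists before the coin of the wave is
revealed, hence can be chosen as a function of the earlier coins (`coreOf_congr`); given these, the
coin misses it with probability at most `f / (3 f + 1)`. So almost surely infinitely many cores are
hit (`ae_exists_mem`). -/

namespace FileDAG

/-! ### Consistency from growth, agreement and unique identities -/

section Consistency
variable {N : ℕ} {L L' : Set (Vertex N)}

theorem Records.mono (h : L ⊆ L') {v : Version N} {tx : Tx N} (hr : Records L v tx) :
    Records L' v tx := by
  obtain ⟨u, hu, h1⟩ := hr
  exact ⟨u, h hu, h1⟩

theorem BFS.mono (h : L ⊆ L') {Q : List (Version N)} {out : List (Tx N)} (hb : BFS L Q out) :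
    BFS L' Q out := by
  induction hb with
  | nil => exact .nil
  | step hr _ ih => exact .step (hr.mono h) ih

theorem Claims.mono {P : Primitives N} {W : Set ℕ} {v : Version N} (h : L ⊆ L')
    (hc : Claims P W L v) : Claims P W L' v := by
  obtain ⟨vs, hvs, hf⟩ := hc
  refine ⟨vs, hvs.mono h, fun c hc => ?_⟩
  obtain ⟨u, hu, hrest⟩ := hf c hc
  exact ⟨u, h hu, hrest⟩

/-- No two vertices of `L` have the same identity. -/
def UniqueIds (L : Set (Vertex N)) : Prop :=
  ∀ u ∈ L, ∀ u' ∈ L, u.id = u'.id → u = u'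

theorem Records.unique (hL : UniqueIds L) {v : Version N} {tx tx' : Tx N}
    (h : Records L v tx) (h' : Records L v tx') : tx = tx' := by
  obtain ⟨u, hu, hid, htx, -⟩ := h
  obtain ⟨u', hu', hid', htx', -⟩ := h'
  obtain rfl := hL u hu u' hu' (hid.trans hid'.symm)
  exact Option.some.inj (htx.symm.trans htx')

theorem BFS.unique (hL : UniqueIds L) {Q : List (Version N)} {out out' : List (Tx N)}
    (h : BFS L Q out) (h' : BFS L Q out') : out = out' := by
  induction h generalizing out' with
  | nil => cases h'; rfl
  | step hr _ ih =>
    cases h' with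
    | step hr' hb' =>
      obtain rfl := hr.unique hL hr'
      rw [ih hb']

theorem Retrieves.unique (hL : UniqueIds L) {v : Version N} {vs vs' : List (Tx N)}
    (h : Retrieves L v vs) (h' : Retrieves L v vs') : vs = vs' :=
  List.reverse_injective (BFS.unique hL h h')

/-- The search starts at `v` and its output is reversed, so the transaction of `v` comes last. When
there is a single previous version, the rest is exactly what retrieving that version returns, which
makes induction along the derivation possible. -/
theorem Retrieves.cases_head (hL : UniqueIds L) {v : Version N} {vs : List (Tx N)} {tx : Tx N}
    (h : Retrieves L v vs) (hr : Records L v tx) :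
    ∃ vs', vs = vs' ++ [tx] ∧ BFS L tx.previous vs'.reverse := by
  unfold Retrieves at h
  generalize hw : vs.reverse = w at h
  cases h with
  | @step _ _ tx' out hr' hb =>
    obtain rfl := hr.unique hL hr'
    refine ⟨out.reverse, ?_, by simpa using hb⟩
    rw [← List.reverse_reverse vs, hw]
    simp

theorem foldl_applyIncrement_congr (P : Primitives N) {data data' : Bits → Bits}
    (vs : List (Tx N)) (h : ∀ c ∈ fragmentsOf vs, data c = data' c) (A : Bits) :
    vs.foldl (applyIncrement P data) A = vs.foldl (applyIncrement P data') A := by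
  induction vs generalizing A with
  | nil => rfl
  | cons tx vs ih =>
    have h1 : applyIncrement P data A tx = applyIncrement P data' A tx := by
      cases tx with
      | update v c => simp [applyIncrement, h c (by simp [fragmentsOf, Tx.fragments])]
      | _ => rfl
    rw [List.foldl_cons, List.foldl_cons, h1]
    exact ih (fun c hc => h c (by
      simp only [fragmentsOf, List.flatMap_cons, List.mem_append] at hc ⊢; exact .inr hc)) _

theorem recover_congr (P : Primitives N) {data data' : Bits → Bits} {vs : List (Tx N)}
    (h : ∀ c ∈ fragmentsOf vs, data c = data' c) : recover P data vs = recover P data' vs := by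
  cases vs with
  | nil => rfl
  | cons tx vs =>
    cases tx with
    | create c =>
      have h0 : data c = data' c := h c (by simp [fragmentsOf, Tx.fragments])
      simp only [recover, h0]
      rw [foldl_applyIncrement_congr P vs fun c hc => h c (by
        simp only [fragmentsOf, List.flatMap_cons, List.mem_append] at hc ⊢; exact .inr hc)]
    | _ => rfl

theorem recover_append (P : Primitives N) {data : Bits → Bits} {vs vs' : List (Tx N)} {A : Bits}
    (h : recover P data vs = some A) :
    recover P data (vs ++ vs') = some (vs'.foldl (applyIncrement P data) A) := by
  cases vs with
  | nil => simp [recover] at h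
  | cons tx vs =>
    cases tx with
    | create c =>
      simp only [recover, Option.some.injEq] at h
      simp [recover, h]
    | _ => simp [recover] at h

/-- Recovery yields the file of a version from any data with the right identifiers. -/
theorem Represents.recover_eq {P : Primitives N} (hcid : Function.Injective P.cid)
    (hpatch : P.DiffPatchCorrect) (hL : UniqueIds L) {v : Version N} {B : Bits}
    (h : Represents P L v B) {vs : List (Tx N)} {data : Bits → Bits} (hv : Retrieves L v vs)
    (hd : ∀ c ∈ fragmentsOf vs, P.cid (data c) = c) : recover P data vs = some B := by
  induction h generalizing vs with
  | @create v B hr =>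
    obtain ⟨vs', rfl, hb⟩ := hv.cases_head hL hr
    have : vs' = [] := by
      generalize hw : vs'.reverse = w at hb
      cases hb
      simpa using hw
    subst this
    have : data (P.cid B) = B := hcid (hd _ (by simp [fragmentsOf, Tx.fragments]))
    simp [recover, this]
  | @update v u A B hr _ ih =>
    obtain ⟨vs', rfl, hb⟩ := hv.cases_head hL hr
    have h1 := ih (vs := vs') hb fun c hc => hd c (by
      simp only [fragmentsOf, List.flatMap_append, List.mem_append] at hc ⊢; exact .inl hc)
    have h2 : data (P.cid (P.diff A B)) = P.diff A B :=
      hcid (hd _ (by simp [fragmentsOf, Tx.fragments]))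
    rw [recover_append P h1]
    simp [applyIncrement, h2, hpatch A B]
  | @fork v u k A hr _ ih =>
    obtain ⟨vs', rfl, hb⟩ := hv.cases_head hL hr
    have h1 := ih (vs := vs') hb fun c hc => hd c (by
      simp only [fragmentsOf, List.flatMap_append, List.mem_append] at hc ⊢; exact .inl hc)
    rw [recover_append P h1]
    simp [applyIncrement]
  -- The merged content is defined by running the recovery on some data with the right identifiers;
  -- injectivity of `cid` makes these agree with `data` on all fragments.
  | merge _ _ _ hv' hd' hrec _ _ =>
    obtain rfl := hv.unique hL hv'
    rw [← hrec]
    exact recover_congr P fun c hc => hcid ((hd c hc).trans (hd' c hc).symm)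

theorem exists_forall_le_of_mono {ι : Type*} {p : ι → ℕ → Prop}
    (hp : ∀ i t t', t ≤ t' → p i t → p i t') (l : List ι) (h : ∀ i ∈ l, ∃ t, p i t) :
    ∃ t, ∀ i ∈ l, p i t := by
  induction l with
  | nil => exact ⟨0, by simp⟩
  | cons i l ih =>
    obtain ⟨t, ht⟩ := ih fun j hj => h j (List.mem_cons_of_mem _ hj)
    obtain ⟨t', ht'⟩ := h i List.mem_cons_self
    refine ⟨max t t', fun j hj => ?_⟩
    rcases List.mem_cons.1 hj with rfl | hj
    · exact hp _ _ _ (le_max_right _ _) ht'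
    · exact hp _ _ _ (le_max_left _ _) (ht j hj)

/-- A search only reads finitely many vertices. -/
theorem BFS.eventually {V : ℕ → Set (Vertex N)} (hV : Monotone V) (hL : ∀ u ∈ L, ∃ t, u ∈ V t)
    {Q : List (Version N)} {out : List (Tx N)} (h : BFS L Q out) : ∃ t, BFS (V t) Q out := by
  induction h with
  | nil => exact ⟨0, .nil⟩
  | step hr _ ih =>
    obtain ⟨t, ht⟩ := ih
    obtain ⟨u, hu, hrest⟩ := hr
    obtain ⟨t', ht'⟩ := hL u hu
    exact ⟨max t t', .step ⟨u, hV (le_max_right t t') ht', hrest⟩ (ht.mono (hV (le_max_left t t')))⟩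

/-- A claim rests on one finite search and one vertex per fragment; growth keeps it true once all of
these have been committed. -/
theorem Claims.eventually {P : Primitives N} {W : Set ℕ} {v : Version N} {V : ℕ → Set (Vertex N)}
    (hV : Monotone V) (hL : ∀ u ∈ L, ∃ t, u ∈ V t) (h : Claims P W L v) :
    ∃ t₀, ∀ t ≥ t₀, Claims P W (V t) v := by
  obtain ⟨vs, hvs, hf⟩ := h
  obtain ⟨t₁, ht₁⟩ := BFS.eventually hV hL hvs
  obtain ⟨t₂, ht₂⟩ := exists_forall_le_of_mono
    (p := fun c t => ∃ u ∈ V t, u.round ∈ W ∧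
      ∃ π, (c, π) ∈ u.block.proofs ∧ P.verify u.source u.round c π = true)
    (fun c t t' htt' => fun ⟨u, hu, h⟩ => ⟨u, hV htt' hu, h⟩) (fragmentsOf vs)
    (fun c hc => by
      obtain ⟨u, hu, h⟩ := hf c hc
      obtain ⟨t, ht⟩ := hL u hu
      exact ⟨t, u, ht, h⟩)
  refine ⟨max t₁ t₂, fun t ht => Claims.mono (hV ht)
    ⟨vs, ht₁.mono (hV (le_max_left _ _)), fun c hc => ?_⟩⟩
  obtain ⟨u, hu, h⟩ := ht₂ c hc
  exact ⟨u, hV (le_max_right _ _) hu, h⟩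

/-- Consistency holds on logs that only grow, agree eventually, and never contain two vertices
with the same identity. -/
theorem meetsConsistency_of_agreement {P : Primitives N} (hcid : Function.Injective P.cid)
    (hpatch : P.DiffPatchCorrect) {H : Finset (Fin N)} {log : Fin N → ℕ → List (Vertex N)}
    (hmono : ∀ p ∈ H, Monotone (view log p))
    (hagree : ∀ p ∈ H, ∀ t, ∀ i ∈ log p t, ∀ q ∈ H, ∃ t', i ∈ log q t')
    (huniq : UniqueIds (ledger H log)) : MeetsConsistency P H log := by
  intro able hout hsound W v p hp t hclaim
  have hsub : view log p t ⊆ ledger H log := fun u hu => ⟨p, hp, t, hu⟩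
  refine ⟨⟨?_, ?_⟩, fun q hq => hclaim.eventually (hmono q hq) fun u hu => hagree p hp t u hu q hq⟩
  · obtain ⟨vs, hvs, hf⟩ := hclaim
    refine ⟨vs, hvs.mono hsub, fun c hc => ?_⟩
    obtain ⟨u, hu, hW, π, hπ, hver⟩ := hf c hc
    -- Soundness yields the copy at the prover itself and in the round of the proving vertex, so
    -- this round lies in `W`.
    obtain ⟨d, hd, hdc⟩ := hsound u.source u.round c π (hout u (hsub hu) _ hπ) hver
    exact ⟨d, hdc, u.source, u.round, hW, hd⟩
  · intro vs data B hvs hd hB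
    exact hB.recover_eq hcid hpatch huniq hvs fun c hc => (hd c hc).1

theorem ByzantineAtomicBroadcast.meetsConsistency {P : Primitives N}
    (hcid : Function.Injective P.cid) (hpatch : P.DiffPatchCorrect) {H : Finset (Fin N)}
    {proposed : Fin N → Vertex N → Prop} {log : Fin N → ℕ → List (Vertex N)}
    (h : ByzantineAtomicBroadcast H proposed log) : MeetsConsistency P H log := by
  have hmono : ∀ p ∈ H, Monotone (view log p) := fun p hp t t' htt' u hu =>
    (h.append_only p hp t t' htt').subset hu
  refine meetsConsistency_of_agreement hcid hpatch hmono h.agreement ?_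
  rintro u ⟨p, hp, t, hu⟩ u' ⟨q, hq, t', hu'⟩ hid
  -- Integrity speaks of a single log, so agreement first brings both vertices into the log of `q`.
  obtain ⟨s, hs⟩ := h.agreement p hp t u hu q hq
  have h1 : u ∈ log q (max s t') := hmono q hq (le_max_left _ _) hs
  have h2 : u' ∈ log q (max s t') := hmono q hq (le_max_right _ _) hu'
  by_contra hne
  have : Std.Symm fun i j : Vertex N => i.id ≠ j.id := ⟨fun _ _ => Ne.symm⟩
  exact (h.integrity q hq (max s t')).forall h1 h2 hne hid

end Consistency

/-! ### Local DAGs, quorum intersection and common cores -/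

section Tables
variable {f : ℕ}

/-- The table `D'` extends the table `D`. -/
def Extends (D D' : Table f) : Prop := ∀ a v, D a = some v → D' a = some v

theorem Extends.refl (D : Table f) : Extends D D := fun _ _ h => h

theorem Extends.trans {D D' D'' : Table f} (h : Extends D D') (h' : Extends D' D'') :
    Extends D D'' := fun a v hv => h' a v (h a v hv)

theorem Extends.update {D : Table f} {a : VertexId (3 * f + 1)} (h : D a = none)
    (o : Option (Vertex (3 * f + 1))) : Extends D (Function.update D a o) := by
  intro b v hv
  rw [Function.update_of_ne, hv]
  rintro rfl
  simp [h] at hv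

theorem Extends.inDag {D D' : Table f} (h : Extends D D') {a : VertexId (3 * f + 1)}
    (ha : InDag D a) : InDag D' a := by
  refine ha.imp_right fun hs => ?_
  obtain ⟨v, hv⟩ := Option.isSome_iff_exists.1 hs
  simp [h a v hv]

theorem Extends.strongPath {D D' : Table f} (h : Extends D D') {a b : VertexId (3 * f + 1)}
    (hp : StrongPath D a b) : StrongPath D' a b :=
  Relation.ReflTransGen.mono (fun _ _ ⟨v, hv, hb⟩ => ⟨v, h _ v hv, hb⟩) _ _ hp

theorem Extends.path {D D' : Table f} (h : Extends D D') {a b : VertexId (3 * f + 1)}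
    (hp : Path D a b) : Path D' a b :=
  Relation.ReflTransGen.mono (fun _ _ ⟨v, hv, hb⟩ => ⟨v, h _ v hv, hb⟩) _ _ hp

theorem strongIds_subset_refs (v : Vertex (3 * f + 1)) : v.strongIds ⊆ v.refs := fun _ h =>
  Finset.mem_union_left _ (Finset.mem_union_left _ h)

theorem StrongPath.path {D : Table f} {a b : VertexId (3 * f + 1)} (hp : StrongPath D a b) :
    Path D a b :=
  Relation.ReflTransGen.mono (fun _ _ ⟨v, hv, hb⟩ => ⟨v, hv, strongIds_subset_refs v hb⟩) _ _ hp

theorem mem_strongIds {v : Vertex (3 * f + 1)} {s : Node f} (h : s ∈ v.strong) :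
    (v.round - 1, s) ∈ v.strongIds :=
  Finset.mem_image_of_mem _ h

theorem WellFormed.ref_lt {v : Vertex (3 * f + 1)} (hv : WellFormed v) {b : VertexId (3 * f + 1)}
    (hb : b ∈ v.refs) : b.1 < v.round := by
  obtain ⟨h1, -, h3, h4⟩ := hv
  simp only [Vertex.refs, Finset.mem_union, Vertex.strongIds, Finset.mem_image] at hb
  rcases hb with (⟨s, -, rfl⟩ | hb) | hb
  · simp only; omega
  · have := h3 b hb; omega
  · exact (h4 b hb).2

/-- A local DAG whose vertices are well-formed, agree with the broadcasts `T`, and only refer to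
vertices of the DAG. -/
structure SoundDag (T D : Table f) : Prop where
  ext : Extends D T
  id_eq : ∀ a v, D a = some v → v.id = a
  wellFormed : ∀ a v, D a = some v → WellFormed v
  closed : ∀ a v, D a = some v → ∀ b ∈ v.refs, InDag D b

theorem SoundDag.mono {T T' D : Table f} (h : SoundDag T D) (hT : Extends T T') :
    SoundDag T' D :=
  ⟨h.ext.trans hT, h.id_eq, h.wellFormed, h.closed⟩

theorem SoundDag.round_eq {T D : Table f} (h : SoundDag T D) {a v} (ha : D a = some v) :
    v.round = a.1 := by rw [← h.id_eq a v ha]; rfl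

theorem SoundDag.one_le {T D : Table f} (h : SoundDag T D) {a v} (ha : D a = some v) :
    1 ≤ a.1 := by
  rw [← h.round_eq ha]; exact (h.wellFormed a v ha).1

/-- The broadcasts determine a vertex by its identity. Round 0 is excluded because genesis vertices
are in every DAG without an entry in the table. -/
theorem SoundDag.eq_some {T D : Table f} (h : SoundDag T D) {a v} (ha : InDag D a)
    (hr : 1 ≤ a.1) (hT : T a = some v) : D a = some v := by
  rcases ha with ha | ha
  · omega
  · obtain ⟨v', hv'⟩ := Option.isSome_iff_exists.1 ha
    rw [hv', ← hT, h.ext a v' hv']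

theorem InDag.exists_eq_some {D : Table f} {a} (ha : InDag D a)
    (hr : 1 ≤ a.1) : ∃ v, D a = some v := by
  rcases ha with ha | ha
  · omega
  · exact Option.isSome_iff_exists.1 ha

theorem SoundDag.strong_inDag {T D : Table f} (h : SoundDag T D) {a v} (ha : D a = some v)
    {s : Node f} (hs : s ∈ v.strong) : InDag D (a.1 - 1, s) := by
  rw [← h.round_eq ha]
  exact h.closed a v ha _ (strongIds_subset_refs v (mem_strongIds hs))

theorem SoundDag.strongPath_of_mem {T D : Table f} (h : SoundDag T D) {a v} (ha : D a = some v)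
    {s : Node f} (hs : s ∈ v.strong) : StrongPath D a (a.1 - 1, s) := by
  refine .single ⟨v, ha, ?_⟩
  rw [← h.round_eq ha]
  exact mem_strongIds hs

theorem SoundDag.path_le {T D : Table f} (h : SoundDag T D) {a b} (hp : Path D a b) :
    b.1 ≤ a.1 := by
  induction hp with
  | refl => exact le_rfl
  | tail _ hs ih =>
    obtain ⟨v, hv, hb⟩ := hs
    have h1 := (h.wellFormed _ v hv).ref_lt hb
    have h2 := h.round_eq hv
    omega

/-- A path of one sound DAG is a path of each other one that contains its first vertex. -/
theorem SoundDag.path_transfer {T D D' : Table f} (h : SoundDag T D) (h' : SoundDag T D') {a b}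
    (hp : Path D a b) (ha : InDag D' a) : Path D' a b ∧ InDag D' b := by
  induction hp with
  | refl => exact ⟨.refl, ha⟩
  | tail _ hs ih =>
    obtain ⟨v, hv, hb⟩ := hs
    have hv' := h'.eq_some ih.2 (h.one_le hv) (h.ext _ v hv)
    exact ⟨ih.1.tail ⟨v, hv', hb⟩, h'.closed _ v hv' _ hb⟩

theorem SoundDag.strongPath_transfer {T D D' : Table f} (h : SoundDag T D) (h' : SoundDag T D')
    {a b} (hp : StrongPath D a b) (ha : InDag D' a) : StrongPath D' a b := by
  suffices StrongPath D' a b ∧ InDag D' b from this.1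
  induction hp with
  | refl => exact ⟨.refl, ha⟩
  | tail _ hs ih =>
    obtain ⟨v, hv, hb⟩ := hs
    have hv' := h'.eq_some ih.2 (h.one_le hv) (h.ext _ v hv)
    exact ⟨ih.1.tail ⟨v, hv', hb⟩, h'.closed _ v hv' _ (strongIds_subset_refs v hb)⟩

/-- Two sets of more than `3 f + 1` nodes in total intersect. -/
theorem exists_mem_of_card {A B : Finset (Node f)} (h : 3 * f + 1 < A.card + B.card) :
    ∃ s, s ∈ A ∧ s ∈ B := by
  by_contra hne
  push Not at hne
  have hd : Disjoint A B := Finset.disjoint_left.2 hne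
  have h1 := Finset.card_union_of_disjoint hd
  have h2 := Finset.card_le_univ (A ∪ B)
  rw [Fintype.card_fin] at h2
  omega

/-- A quorum of vertices in the last round of wave `w` have strong paths to its leader. -/
def DirectCommit (ω : Coins f) (D : Table f) (w : ℕ) : Prop :=
  1 ≤ w ∧ ∃ Q : Finset (Node f), 2 * f + 1 ≤ Q.card ∧
    ∀ s ∈ Q, InDag D (4 * w, s) ∧ StrongPath D (4 * w, s) (leader ω w)

theorem DirectCommit.mono {ω : Coins f} {D D' : Table f} {w : ℕ} (h : DirectCommit ω D w)
    (hD : Extends D D') : DirectCommit ω D' w := by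
  obtain ⟨hw, Q, hQ, hs⟩ := h
  exact ⟨hw, Q, hQ, fun s hsQ => ⟨hD.inDag (hs s hsQ).1, hD.strongPath (hs s hsQ).2⟩⟩

/-- All later vertices have strong paths to a leader that is committed directly. -/
theorem DirectCommit.strongPath {ω : Coins f} {T D D' : Table f} {w : ℕ}
    (h : DirectCommit ω D w) (hD : SoundDag T D) (hD' : SoundDag T D') (k : ℕ) (s : Node f)
    (ha : InDag D' (4 * w + 1 + k, s)) : StrongPath D' (4 * w + 1 + k, s) (leader ω w) := by
  obtain ⟨v, hv⟩ := InDag.exists_eq_some ha (by simp; omega)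
  have hcard := (hD'.wellFormed _ v hv).2.1
  induction k generalizing s v with
  | zero =>
    obtain ⟨hw, Q, hQ, hs⟩ := h
    -- Two quorums of `2 f + 1` nodes intersect. The path from the common vertex is known in `D` and
    -- is moved to `D'`; in later rounds any one strong edge suffices.
    obtain ⟨s', h1, h2⟩ := exists_mem_of_card (A := Q) (B := v.strong) (by omega)
    have h3 := hD'.strong_inDag hv h2
    exact (hD'.strongPath_of_mem hv h2).trans (hD.strongPath_transfer hD' (hs s' h1).2 h3)
  | succ k ih =>
    obtain ⟨s', hs'⟩ := Finset.card_pos.1 (show 0 < v.strong.card by omega)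
    have h3 := hD'.strong_inDag hv hs'
    obtain ⟨v', hv'⟩ := InDag.exists_eq_some h3 (by simp; omega)
    exact (hD'.strongPath_of_mem hv hs').trans
      (ih s' h3 v' hv' (hD'.wellFormed _ v' hv').2.1)

/-- The vertices in the set `V` of the first round of wave `w` have a strong path from every
vertex of its last round: they are referred to by a vertex `u`, to which `f + 1` vertices refer. -/
def CommonCore (T : Table f) (w : ℕ) (V : Finset (Node f)) : Prop :=
  2 * f + 1 ≤ V.card ∧ ∃ u x, T (4 * w - 2, u) = some x ∧ x.strong = V ∧
    ∃ R : Finset (Node f), f + 1 ≤ R.card ∧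
      ∀ s ∈ R, ∃ y, T (4 * w - 1, s) = some y ∧ u ∈ y.strong

theorem CommonCore.mono {T T' : Table f} {w : ℕ} {V : Finset (Node f)} (h : CommonCore T w V)
    (hT : Extends T T') : CommonCore T' w V := by
  obtain ⟨hV, u, x, hx, hxV, R, hR, hs⟩ := h
  refine ⟨hV, u, x, hT _ _ hx, hxV, R, hR, fun s hsR => ?_⟩
  obtain ⟨y, hy, hu⟩ := hs s hsR
  exact ⟨y, hT _ _ hy, hu⟩

/-- A last-round vertex has `2 f + 1` strong edges, which meet the `f + 1` vertices referring to `u`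
because `(f + 1) + (2 f + 1) > 3 f + 1`; from `u` one more edge reaches each member of the core. The
core is only known in the broadcasts `T`: closure under references brings its vertices into `D`. -/
theorem CommonCore.strongPath {T D : Table f} {w : ℕ} {V : Finset (Node f)}
    (h : CommonCore T w V) (hw : 1 ≤ w) (hD : SoundDag T D) {s l : Node f} (hl : l ∈ V)
    (ha : InDag D (4 * w, s)) : StrongPath D (4 * w, s) (4 * w - 3, l) ∧
      InDag D (4 * w - 3, l) := by
  obtain ⟨-, u, x, hx, rfl, R, hR, hs⟩ := h
  obtain ⟨z, hz⟩ := InDag.exists_eq_some ha (by simp; omega)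
  obtain ⟨s', h1, h2⟩ := exists_mem_of_card (A := R) (B := z.strong)
    (by have := (hD.wellFormed _ z hz).2.1; omega)
  obtain ⟨y, hy, hu⟩ := hs s' h1
  have hy' := hD.eq_some (hD.strong_inDag hz h2) (by simp; omega) hy
  have hx' := hD.eq_some (hD.strong_inDag hy' hu) (by simp; omega) hx
  exact ⟨((hD.strongPath_of_mem hz h2).trans (hD.strongPath_of_mem hy' hu)).trans
    (hD.strongPath_of_mem hx' hl), hD.strong_inDag hx' hl⟩

theorem mem_sources {D : Table f} {r : ℕ} {s : Node f} : s ∈ sources D r ↔ InDag D (r, s) := by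
  simp [sources]

/-- Among `2 f + 1` sets of `2 f + 1` nodes, some node lies in `f + 1` of the sets. -/
theorem exists_popular (R : Finset (Node f)) (hR : 2 * f + 1 ≤ R.card)
    (S : Node f → Finset (Node f)) (hS : ∀ s ∈ R, 2 * f + 1 ≤ (S s).card) :
    ∃ u, f + 1 ≤ (R.filter fun s => u ∈ S s).card := by
  by_contra! hne
  -- Double counting of the pairs `u ∈ S s`: there are at least `(2 f + 1) ^ 2` of them, but at most
  -- `(3 f + 1) * f` if every `u` lies in at most `f` sets.
  have h1 : ∑ s ∈ R, (S s).card = ∑ u : Node f, (R.filter fun s => u ∈ S s).card := by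
    simp only [Finset.card_filter]
    rw [Finset.sum_comm]
    refine Finset.sum_congr rfl fun s _ => ?_
    simp
  have h2 : R.card * (2 * f + 1) ≤ ∑ s ∈ R, (S s).card := by
    simpa using Finset.card_nsmul_le_sum R _ _ hS
  have h3 : ∑ u : Node f, (R.filter fun s => u ∈ S s).card ≤ (3 * f + 1) * f := by
    simpa using Finset.sum_le_card_nsmul (Finset.univ : Finset (Node f)) _ f
      fun u _ => Nat.lt_succ_iff.1 (hne u)
  nlinarith

/-- A DAG in which the last round of wave `w` is complete contains a common core. -/
theorem SoundDag.exists_commonCore {T D : Table f} (hD : SoundDag T D) {w : ℕ} (hw : 1 ≤ w)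
    (hc : 2 * f + 1 ≤ (sources D (4 * w)).card) : ∃ V, CommonCore T w V := by
  classical
  obtain ⟨s, hs⟩ := Finset.card_pos.1 (show 0 < (sources D (4 * w)).card by omega)
  obtain ⟨z, hz⟩ := InDag.exists_eq_some (mem_sources.1 hs) (by simp; omega)
  have hR : ∀ s ∈ z.strong, ∃ y, D (4 * w - 1, s) = some y := fun s hs =>
    InDag.exists_eq_some (hD.strong_inDag hz hs) (by simp; omega)
  have : Nonempty (Vertex (3 * f + 1)) := ⟨z⟩
  choose! y hy using hR
  -- A single last-round vertex `z` supplies `2 f + 1` vertices of the third round; one second-round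
  -- vertex `u` is referred to by `f + 1` of these, and its strong edges form the core.
  obtain ⟨u, hu⟩ := exists_popular z.strong (hD.wellFormed _ z hz).2.1 (fun s => (y s).strong)
    fun s hs => (hD.wellFormed _ _ (hy s hs)).2.1
  obtain ⟨s', hs'⟩ := Finset.card_pos.1 (lt_of_lt_of_le (Nat.succ_pos f) hu)
  rw [Finset.mem_filter] at hs'
  obtain ⟨x, hx⟩ := InDag.exists_eq_some
    (hD.strong_inDag (hy s' hs'.1) hs'.2) (by simp; omega)
  refine ⟨x.strong, (hD.wellFormed _ x hx).2.1, u, x, hD.ext _ _ hx, rfl, _, hu, fun s hs => ?_⟩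
  rw [Finset.mem_filter] at hs
  exact ⟨y s, hD.ext _ _ (hy s hs.1), hs.2⟩

/-! ### Committing -/

/-- Only the set of committed vertices matters for agreement, so the order is discarded. Listing the
rounds up to that of `a` misses nothing, as paths never go up. -/
theorem mem_commitHistory {T D : Table f} (hD : SoundDag T D) {log : List (Vertex (3 * f + 1))}
    {a : VertexId (3 * f + 1)} {v : Vertex (3 * f + 1)} :
    v ∈ commitHistory D log a ↔ v ∈ log ∨ (D v.id = some v ∧ Path D a v.id) := by
  simp only [commitHistory, List.mem_append, List.mem_filter, List.mem_filterMap,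
    List.mem_flatMap, List.mem_range, List.mem_map, List.mem_finRange, true_and,
    decide_eq_true_eq]
  constructor
  · rintro (h | ⟨⟨b, -, hb⟩, hp, -⟩)
    · exact .inl h
    · rw [← hD.id_eq b v hb] at hb
      exact .inr ⟨hb, hp⟩
  · rintro (h | ⟨hb, hp⟩)
    · exact .inl h
    · by_cases hv : v ∈ log
      · exact .inl hv
      · exact .inr ⟨⟨v.id, ⟨v.id.1, Nat.lt_succ_of_le (hD.path_le hp), v.id.2, rfl⟩, hb⟩, hp, hv⟩

theorem prefix_commitHistory (D : Table f) (log : List (Vertex (3 * f + 1)))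
    (a : VertexId (3 * f + 1)) : log <+: commitHistory D log a :=
  List.prefix_append _ _

theorem prefix_foldl_commitHistory (D : Table f) (l : List (VertexId (3 * f + 1)))
    (log : List (Vertex (3 * f + 1))) : log <+: l.foldl (commitHistory D) log := by
  induction l generalizing log with
  | nil => exact List.prefix_rfl
  | cons a l ih => exact (prefix_commitHistory D log a).trans (ih _)

theorem mem_foldl_commitHistory {T D : Table f} (hD : SoundDag T D)
    (l : List (VertexId (3 * f + 1))) {log : List (Vertex (3 * f + 1))}
    {v : Vertex (3 * f + 1)} :
    v ∈ l.foldl (commitHistory D) log ↔ v ∈ log ∨ (D v.id = some v ∧ ∃ a ∈ l, Path D a v.id) := by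
  induction l generalizing log with
  | nil => simp
  | cons a l ih =>
    rw [List.foldl_cons, ih, mem_commitHistory hD]
    simp only [List.mem_cons, exists_eq_or_imp]
    tauto

theorem strongPath_of_mem_earlierLeaders {ω : Coins f} {D : Table f} {d : ℕ} (k : ℕ)
    {a b : VertexId (3 * f + 1)} (h : b ∈ earlierLeaders ω D d k a) : StrongPath D a b := by
  induction k generalizing a with
  | zero => simp [earlierLeaders] at h
  | succ k ih =>
    rw [earlierLeaders] at h
    split_ifs at h with hc
    · rcases List.mem_cons.1 h with rfl | h
      · exact hc.2
      · exact hc.2.trans (ih h)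
    · exact ih h

theorem earlierLeaders_congr {ω ω' : Coins f} {D : Table f} {d : ℕ} (k : ℕ)
    (h : ∀ i, d < i → i ≤ d + k → ω i = ω' i) (a : VertexId (3 * f + 1)) :
    earlierLeaders ω D d k a = earlierLeaders ω' D d k a := by
  induction k generalizing a with
  | zero => rfl
  | succ k ih =>
    have hl : leader ω (d + k + 1) = leader ω' (d + k + 1) := by
      simp only [leader, h (d + k + 1) (by omega) (by omega)]
    have ih' := ih fun i h1 h2 => h i h1 (by omega)
    rw [earlierLeaders, earlierLeaders, hl, ih', ih']

/-- The earlier leaders consulted belong to waves before `w`. This bound on the coins used makes the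
run independent of future coins. -/
theorem completeWave_congr {ω ω' : Coins f} {w : ℕ} (h : ∀ i ≤ w, ω i = ω' i)
    (S : LocalState f) : completeWave ω w S = completeWave ω' w S := by
  have hl : leader ω w = leader ω' w := by simp only [leader, h w le_rfl]
  have he := earlierLeaders_congr (ω := ω) (ω' := ω') (D := S.dag) (d := S.decidedWave)
    (w - 1 - S.decidedWave) (fun i h1 h2 => h i (by omega)) (leader ω' w)
  rw [completeWave, completeWave, hl, he]

@[simp] theorem completeWave_dag (ω : Coins f) (w : ℕ) (S : LocalState f) :
    (completeWave ω w S).dag = S.dag := by unfold completeWave; split_ifs <;> rfl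

@[simp] theorem completeWave_buffer (ω : Coins f) (w : ℕ) (S : LocalState f) :
    (completeWave ω w S).buffer = S.buffer := by unfold completeWave; split_ifs <;> rfl

@[simp] theorem completeWave_round (ω : Coins f) (w : ℕ) (S : LocalState f) :
    (completeWave ω w S).round = S.round := by unfold completeWave; split_ifs <;> rfl

theorem prefix_completeWave_log (ω : Coins f) (w : ℕ) (S : LocalState f) :
    S.log <+: (completeWave ω w S).log := by
  unfold completeWave
  split_ifs
  · exact prefix_foldl_commitHistory _ _ _
  · exact List.prefix_rfl

/-- Earlier leaders are committed only along strong paths from leader `w`, so their histories lie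
within its own. Hence one directly committed leader accounts for every new entry. -/
theorem mem_completeWave_log {ω : Coins f} {w : ℕ} (hw : 1 ≤ w) {S : LocalState f} {T : Table f}
    (hD : SoundDag T S.dag) {u : Vertex (3 * f + 1)} (hu : u ∈ (completeWave ω w S).log) :
    u ∈ S.log ∨ (DirectCommit ω S.dag w ∧ S.dag u.id = some u ∧
      Path S.dag (leader ω w) u.id) := by
  classical
  unfold completeWave at hu
  split_ifs at hu with hc
  · rw [mem_foldl_commitHistory hD] at hu
    refine hu.imp_right fun ⟨h1, a, ha, hp⟩ => ⟨⟨hw, _, hc.2, fun s hs => ?_⟩, h1, ?_⟩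
    · rw [Finset.mem_filter, mem_sources] at hs
      exact hs
    · rw [List.mem_reverse, List.mem_cons] at ha
      rcases ha with rfl | ha
      · exact hp
      · exact (strongPath_of_mem_earlierLeaders _ ha).path.trans hp
  · exact .inl hu

/-- A node commits the causal history of the leader if all vertices of the last round of the wave
have strong paths to it. -/
theorem mem_completeWave_log_of_path {ω : Coins f} {w : ℕ} {S : LocalState f} {T : Table f}
    (hD : SoundDag T S.dag) (hl : InDag S.dag (leader ω w))
    (hc : 2 * f + 1 ≤ (sources S.dag (4 * w)).card)
    (hs : ∀ s, InDag S.dag (4 * w, s) → StrongPath S.dag (4 * w, s) (leader ω w))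
    {u : Vertex (3 * f + 1)} (hu : S.dag u.id = some u) (hp : Path S.dag (leader ω w) u.id) :
    u ∈ (completeWave ω w S).log := by
  classical
  unfold completeWave
  rw [if_pos]
  · simp only
    rw [mem_foldl_commitHistory hD]
    exact .inr ⟨hu, leader ω w, by simp, hp⟩
  · refine ⟨hl, ?_⟩
    rwa [Finset.filter_true_of_mem]
    exact fun s hsr => hs s (mem_sources.1 hsr)

/-! ### Proposing -/

theorem inDag_of_mem_weakEdges {D : Table f} {r : ℕ} {base : Finset (VertexId (3 * f + 1))}
    {b : VertexId (3 * f + 1)} (hb : b ∈ weakEdges D r base) : InDag D b := by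
  classical
  unfold weakEdges at hb
  generalize (List.range' 1 (r - 2)).reverse = l at hb
  have key : ∀ E : Finset (VertexId (3 * f + 1)), (∀ b ∈ E, InDag D b) → ∀ b ∈ l.foldl
      (fun E k => E ∪ ((sources D k).filter fun s => ¬ ∃ a ∈ base ∪ E, Path D a (k, s)).image
        fun s => (k, s)) E, InDag D b := by
    clear hb
    induction l with
    | nil => exact fun E hE => hE
    | cons k l ih =>
      intro E hE
      rw [List.foldl_cons]
      refine ih _ fun b hb => ?_
      rw [Finset.mem_union, Finset.mem_image] at hb
      rcases hb with hb | ⟨s, hs, rfl⟩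
      · exact hE b hb
      · exact mem_sources.1 (Finset.mem_filter.1 hs).1
  refine key ∅ (by simp) b ?_
  convert hb

/-- Strong and weak edges are read off the DAG. Lower-layer edges pass the check of `checkedBlock`
only if they end at committed vertices, and these are in the DAG by `hlog`. -/
theorem inDag_of_mem_refs_newVertex {p : Node f} {r : ℕ} {b : Block (3 * f + 1)}
    {S : LocalState f} (hlog : ∀ u ∈ S.log, S.dag u.id = some u) {a : VertexId (3 * f + 1)}
    (ha : a ∈ (newVertex p (r + 1) b S).refs) : InDag S.dag a := by
  simp only [newVertex, Vertex.refs, Vertex.strongIds, Finset.mem_union, Finset.mem_image] at ha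
  rcases ha with (⟨s, hs, rfl⟩ | ha) | ha
  · exact mem_sources.1 hs
  · exact inDag_of_mem_weakEdges ha
  · unfold checkedBlock at ha
    split_ifs at ha with hc
    · rw [Block.lowerIds, List.mem_toFinset] at ha
      cases htx : b.tx with
      | none => simp [htx] at ha
      | some tx =>
        rw [htx] at ha
        obtain ⟨v, hv, rfl⟩ := List.mem_map.1 ha
        obtain ⟨tx', u, hu, hid, -⟩ := hc tx htx v hv
        rw [← hid]
        exact .inr (by simp [hlog u hu])
    · simp [Block.lowerIds] at ha

end Tables

/-! ### Steps of the protocol and the invariant they preserve -/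

section Invariants
variable {f : ℕ} {H : Finset (Node f)} {ω : Coins f}

/-- The state `S'` is later than the state `S` of the same node. -/
structure LocalState.Before (S S' : LocalState f) : Prop where
  round : S.round ≤ S'.round
  dag : Extends S.dag S'.dag
  log : S.log <+: S'.log
  delivered : ∀ a, Delivered S a → Delivered S' a

theorem LocalState.Before.refl (S : LocalState f) : S.Before S :=
  ⟨le_rfl, .refl _, List.prefix_rfl, fun _ h => h⟩

theorem LocalState.Before.trans {S S' S'' : LocalState f} (h : S.Before S') (h' : S'.Before S'') :
    S.Before S'' :=
  ⟨h.round.trans h'.round, h.dag.trans h'.dag, h.log.trans h'.log,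
    fun a ha => h'.delivered a (h.delivered a ha)⟩

/-- The state of a node agrees with the broadcasts `T` and the coins `ω`. -/
structure LocalInvariant (ω : Coins f) (T : Table f) (S : LocalState f) : Prop where
  buffer : ∀ a v, S.buffer a = some v → T a = some v ∧ v.id = a ∧ WellFormed v
  dag : SoundDag T S.dag
  log : ∀ u ∈ S.log, S.dag u.id = some u ∧
    ∃ w, DirectCommit ω S.dag w ∧ Path S.dag (leader ω w) u.id

theorem LocalInvariant.mono {T T' : Table f} {S : LocalState f} (h : LocalInvariant ω T S)
    (hT : Extends T T') : LocalInvariant ω T' S :=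
  ⟨fun a v hv => ⟨hT a v (h.buffer a v hv).1, (h.buffer a v hv).2⟩, h.dag.mono hT, h.log⟩

/-- The invariant of all runs. Honest nodes have proposed exactly in the rounds that they have
entered, and their vertices only refer to their own DAGs. -/
structure Invariant (H : Finset (Node f)) (ω : Coins f) (G : GlobalState f) : Prop where
  sent_id : ∀ a v, G.sent a = some v → v.id = a
  node : ∀ p, LocalInvariant ω G.sent (G.node p)
  own : ∀ p ∈ H, ∀ r v, G.sent (r, p) = some v →
    r ≤ (G.node p).round ∧ ∀ b ∈ v.refs, InDag (G.node p).dag b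
  own_isSome : ∀ p ∈ H, ∀ r, 1 ≤ r → r ≤ (G.node p).round → (G.sent (r, p)).isSome

theorem invariant_initialState : Invariant H ω (initialState f) where
  sent_id := by simp [initialState]
  node p := ⟨by simp [initialState],
    ⟨by simp [initialState, Extends], by simp [initialState], by simp [initialState],
      by simp [initialState]⟩, by simp [initialState]⟩
  own := by simp [initialState]
  own_isSome := by
    intro p _ r h1 h2
    simp only [initialState] at h2
    omega

/-- The state of a node after the checks that it makes at the end of its round. -/
noncomputable def endRound (ω : Coins f) (S : LocalState f) : LocalState f :=
  if 0 < S.round ∧ S.round % 4 = 0 then completeWave ω (S.round / 4) S else S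

@[simp] theorem endRound_dag (S : LocalState f) : (endRound ω S).dag = S.dag := by
  unfold endRound; split_ifs <;> simp

@[simp] theorem endRound_buffer (S : LocalState f) : (endRound ω S).buffer = S.buffer := by
  unfold endRound; split_ifs <;> simp

theorem prefix_endRound_log (S : LocalState f) : S.log <+: (endRound ω S).log := by
  unfold endRound
  split_ifs
  · exact prefix_completeWave_log _ _ _
  · exact List.prefix_rfl

theorem LocalInvariant.endRound {T : Table f} {S : LocalState f} (h : LocalInvariant ω T S) :
    LocalInvariant ω T (endRound ω S) := by
  refine ⟨by simpa using h.buffer, by simpa using h.dag, fun u hu => ?_⟩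
  rw [endRound_dag]
  unfold FileDAG.endRound at hu
  split_ifs at hu with hc
  · rcases mem_completeWave_log (by omega) h.dag hu with hu | ⟨h1, h2, h3⟩
    · exact h.log u hu
    · exact ⟨h2, _, h1, h3⟩
  · exact h.log u hu

/-- The possible effects of an action. -/
inductive Step (H : Finset (Node f)) (ω : Coins f) (G : GlobalState f) : GlobalState f → Prop
  | stay : Step H ω G G
  | broadcast (v : Vertex (3 * f + 1)) : v.source ∉ H → G.sent v.id = none →
      Step H ω G { G with sent := Function.update G.sent v.id (some v) }
  | deliver (p : Node f) (a : VertexId (3 * f + 1)) (v : Vertex (3 * f + 1)) :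
      (G.node p).buffer a = none → G.sent a = some v → WellFormed v →
      Step H ω G (G.setNode p { G.node p with
        buffer := Function.update (G.node p).buffer a (some v) })
  | accept (p : Node f) (a : VertexId (3 * f + 1)) (v : Vertex (3 * f + 1)) :
      (G.node p).buffer a = some v → Includable (G.node p) v →
      Step H ω G (G.setNode p { G.node p with
        buffer := Function.update (G.node p).buffer a none
        dag := Function.update (G.node p).dag a (some v) })
  | advance (p : Node f) (v : Vertex (3 * f + 1)) : p ∈ H → RoundComplete (G.node p) →
      v.id = ((G.node p).round + 1, p) →
      (LocalInvariant ω G.sent (G.node p) → ∀ b ∈ v.refs, InDag (G.node p).dag b) →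
      Step H ω G { G.setNode p { endRound ω (G.node p) with round := (G.node p).round + 1 } with
        sent := Function.update G.sent v.id (some v) }

/-- Of a proposed vertex, `Step` keeps just its identity and the fact that its references lie in the
DAG of its proposer. The latter depends on the log being part of the DAG, hence is conditional on
the local invariant. -/
theorem step_apply (G : GlobalState f) (act : Action f) : Step H ω G (apply H ω G act) := by
  cases act with
  | broadcast v =>
    simp only [apply]
    split_ifs with h
    · exact .broadcast v h.1 h.2
    · exact .stay
  | deliver p a =>
    simp only [apply]
    split_ifs with h
    · obtain ⟨-, h1, -, v, h2, h3⟩ := h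
      rw [h2]
      exact .deliver p a v h1 h2 h3
    · exact .stay
  | accept p a =>
    simp only [apply]
    split_ifs with h
    · obtain ⟨-, v, h1, h2⟩ := h
      rw [h1]
      exact .accept p a v h1 h2
    · exact .stay
  | advance p b =>
    have key (h : p ∈ H ∧ RoundComplete (G.node p)) := Step.advance (ω := ω) (G := G) p
      (newVertex p ((G.node p).round + 1) b (endRound ω (G.node p))) h.1 h.2 rfl fun hI b hb => by
        have := inDag_of_mem_refs_newVertex (fun u hu => (hI.endRound.log u hu).1) hb
        simpa using this
    simp only [apply]
    split_ifs with h h'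
    · have hE : endRound ω (G.node p) = completeWave ω ((G.node p).round / 4) (G.node p) :=
        if_pos h'
      simpa only [hE, completeWave_round] using key h
    · have hE : endRound ω (G.node p) = G.node p := if_neg h'
      simpa only [hE] using key h
    · exact .stay

theorem setNode_node (G : GlobalState f) (p q : Node f) (S : LocalState f) :
    (G.setNode p S).node q = if q = p then S else G.node q := by
  simp [GlobalState.setNode, Function.update_apply]

theorem Invariant.setNode {G : GlobalState f} (h : Invariant H ω G) {p : Node f}
    {S : LocalState f} (hS : LocalInvariant ω G.sent S) (hB : (G.node p).Before S)
    (hr : S.round = (G.node p).round) : Invariant H ω (G.setNode p S) := by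
  refine ⟨h.sent_id, fun q => ?_, fun q hq r v hv => ?_, fun q hq r h1 h2 => ?_⟩
  · rw [setNode_node]
    split_ifs
    · exact hS
    · exact h.node q
  · rw [setNode_node]
    have h1 := h.own q hq r v hv
    split_ifs with hqp
    · subst hqp
      exact ⟨hr ▸ h1.1, fun b hb => hB.dag.inDag (h1.2 b hb)⟩
    · exact h1
  · rw [setNode_node] at h2
    refine h.own_isSome q hq r h1 ?_
    split_ifs at h2 with hqp
    · subst hqp
      exact hr ▸ h2
    · exact h2

theorem before_setNode {G : GlobalState f} {p : Node f} {S : LocalState f}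
    (hB : (G.node p).Before S) (q : Node f) : (G.node q).Before ((G.setNode p S).node q) := by
  rw [setNode_node]
  split_ifs with hqp
  · exact hqp ▸ hB
  · exact .refl _

/-- A step preserves the invariant, and states only grow. -/
theorem Step.invariant {G G' : GlobalState f} (hs : Step H ω G G') (h : Invariant H ω G) :
    Invariant H ω G' ∧ Extends G.sent G'.sent ∧ ∀ q, (G.node q).Before (G'.node q) := by
  cases hs with
  | stay => exact ⟨h, .refl _, fun q => .refl _⟩
  | broadcast v hv hn =>
    have hext := Extends.update hn (some v)
    refine ⟨⟨fun a u hu => ?_, fun p => (h.node p).mono hext, fun p hp r u hu => ?_,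
      fun p hp r h1 h2 => ?_⟩, hext, fun q => .refl _⟩
    · simp only [Function.update_apply] at hu
      split_ifs at hu with ha
      · rw [ha, Option.some.inj hu]
      · exact h.sent_id a u hu
    · simp only [Function.update_apply] at hu
      split_ifs at hu with ha
      · refine absurd hp ?_
        have : p = v.source := congrArg Prod.snd ha
        rwa [this]
      · exact h.own p hp r u hu
    · obtain ⟨u, hu⟩ := Option.isSome_iff_exists.1 (h.own_isSome p hp r h1 h2)
      exact Option.isSome_iff_exists.2 ⟨u, hext _ _ hu⟩
  | deliver p a v hb hv hW =>
    have hB : (G.node p).Before { G.node p with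
        buffer := Function.update (G.node p).buffer a (some v) } := by
      refine ⟨le_rfl, .refl _, List.prefix_rfl, fun b hb => ?_⟩
      refine hb.imp_left fun hb => ?_
      simp only [Function.update_apply]
      split_ifs
      · rfl
      · exact hb
    refine ⟨h.setNode ⟨fun b u hu => ?_, (h.node p).dag, (h.node p).log⟩ hB rfl, .refl _,
      before_setNode hB⟩
    simp only [Function.update_apply] at hu
    split_ifs at hu with hba
    · subst hba
      obtain rfl := Option.some.inj hu
      exact ⟨hv, h.sent_id _ _ hv, hW⟩
    · exact (h.node p).buffer b u hu
  | accept p a v hb hi =>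
    obtain ⟨hv, hid, hW⟩ := (h.node p).buffer a v hb
    -- `Step` does not say that slot `a` of the DAG is free, but an old entry would agree with the
    -- broadcast, as the buffered vertex does.
    have hext : Extends (G.node p).dag (Function.update (G.node p).dag a (some v)) := by
      intro b u hu
      rw [Function.update_apply]
      split_ifs with hba
      · subst hba
        rw [← hv, (h.node p).dag.ext _ u hu]
      · exact hu
    have hB : (G.node p).Before { G.node p with
        buffer := Function.update (G.node p).buffer a none
        dag := Function.update (G.node p).dag a (some v) } := by
      refine ⟨le_rfl, hext, List.prefix_rfl, fun b hb => ?_⟩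
      by_cases hba : b = a
      · right; simp [hba]
      · simpa [Delivered, hba] using hb
    have hnew : ∀ b u, Function.update (G.node p).dag a (some v) b = some u →
        (b = a ∧ u = v) ∨ (G.node p).dag b = some u := by
      intro b u hu
      rw [Function.update_apply] at hu
      split_ifs at hu with hba
      · exact .inl ⟨hba, (Option.some.inj hu).symm⟩
      · exact .inr hu
    refine ⟨h.setNode ⟨fun b u hu => ?_, ⟨fun b u hu => ?_, fun b u hu => ?_, fun b u hu => ?_,
      fun b u hu c hc => hext.inDag ?_⟩, fun u hu => ?_⟩ hB rfl, .refl _, before_setNode hB⟩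
    · simp only [Function.update_apply] at hu
      split_ifs at hu
      exact (h.node p).buffer b u hu
    · rcases hnew b u hu with ⟨rfl, rfl⟩ | hu
      · exact hv
      · exact (h.node p).dag.ext b u hu
    · rcases hnew b u hu with ⟨rfl, rfl⟩ | hu
      · exact hid
      · exact (h.node p).dag.id_eq b u hu
    · rcases hnew b u hu with ⟨rfl, rfl⟩ | hu
      · exact hW
      · exact (h.node p).dag.wellFormed b u hu
    · rcases hnew b u hu with ⟨rfl, rfl⟩ | hu
      · exact hi.2 c hc
      · exact (h.node p).dag.closed b u hu c hc
    · obtain ⟨h1, w, h2, h3⟩ := (h.node p).log u hu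
      exact ⟨hext _ _ h1, w, h2.mono hext, hext.path h3⟩
  | advance p v hp hc hid hrefs =>
    -- An honest node has proposed only in rounds it has entered, so the slot for its next round is
    -- free.
    have hn : G.sent v.id = none := by
      rw [hid]
      by_contra hne
      obtain ⟨u, hu⟩ := Option.ne_none_iff_exists'.1 hne
      have := (h.own p hp _ u hu).1
      omega
    have hext := Extends.update hn (some v)
    have hE := (h.node p).endRound
    have hB : (G.node p).Before { endRound ω (G.node p) with round := (G.node p).round + 1 } :=
      ⟨Nat.le_succ _, by simpa using Extends.refl _, prefix_endRound_log _, by simp [Delivered]⟩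
    refine ⟨⟨fun a u hu => ?_, fun q => ?_, fun q hq r u hu => ?_, fun q hq r h1 h2 => ?_⟩, hext,
      before_setNode hB⟩
    · simp only [Function.update_apply] at hu
      split_ifs at hu with ha
      · rw [ha, Option.some.inj hu]
      · exact h.sent_id a u hu
    · simp only [setNode_node]
      split_ifs
      · exact LocalInvariant.mono ⟨hE.buffer, hE.dag, hE.log⟩ hext
      · exact (h.node q).mono hext
    · simp only [Function.update_apply] at hu
      simp only [setNode_node]
      split_ifs at hu with ha
      · rw [hid, Prod.mk.injEq] at ha
        obtain ⟨rfl, rfl⟩ := ha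
        obtain rfl := Option.some.inj hu
        simpa using hrefs (h.node q)
      · have h3 := h.own q hq r u hu
        split_ifs with hqp
        · subst hqp
          exact ⟨h3.1.trans (Nat.le_succ _), by simpa using h3.2⟩
        · exact h3
    · simp only [setNode_node] at h2
      simp only [Function.update_apply]
      split_ifs with ha
      · rfl
      · refine h.own_isSome q hq r h1 ?_
        split_ifs at h2 with hqp
        · subst hqp
          simp only at h2
          have : r ≠ (G.node q).round + 1 := fun hr => ha (by rw [hid, hr])
          omega
        · exact h2

/-- A node that changes its round completes the round before, and proceeds by one round. -/
theorem Step.round {G G' : GlobalState f} (hs : Step H ω G G') (q : Node f) :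
    (G'.node q).round = (G.node q).round ∨
      (RoundComplete (G.node q) ∧ (G'.node q).round = (G.node q).round + 1 ∧
        (G'.node q).log = (endRound ω (G.node q)).log) := by
  cases hs with
  | stay => exact .inl rfl
  | broadcast v => exact .inl rfl
  | deliver p a v =>
    left; rw [setNode_node]; split_ifs with h <;> simp [h]
  | accept p a v =>
    left; rw [setNode_node]; split_ifs with h <;> simp [h]
  | advance p v hp hc =>
    simp only [setNode_node]
    split_ifs with h
    · subst h
      exact .inr ⟨hc, rfl, rfl⟩
    · exact .inl rfl

end Invariants

/-! ### Progress and agreement in fair runs -/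

section Runs
variable {f : ℕ} {H : Finset (Node f)} {ω : Coins f} {adv : Adversary f}

theorem step_run (t : ℕ) : Step H ω (run H adv ω t) (run H adv ω (t + 1)) := step_apply _ _

theorem invariant_run (t : ℕ) : Invariant H ω (run H adv ω t) := by
  induction t with
  | zero => exact invariant_initialState
  | succ t ih => exact ((step_run t).invariant ih).1

theorem extends_sent_run {t t' : ℕ} (h : t ≤ t') :
    Extends (run H adv ω t).sent (run H adv ω t').sent := by
  induction h with
  | refl => exact .refl _
  | step _ ih => exact ih.trans ((step_run _).invariant (invariant_run _)).2.1

theorem before_run {t t' : ℕ} (h : t ≤ t') (q : Node f) :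
    ((run H adv ω t).node q).Before ((run H adv ω t').node q) := by
  induction h with
  | refl => exact .refl _
  | step _ ih => exact ih.trans (((step_run _).invariant (invariant_run _)).2.2 q)

/-- A delivered vertex enters the DAG when the node is in its round and knows its references. -/
theorem exists_inDag_of_delivered (hF : Fair H (run H adv ω)) {q : Node f} (hq : q ∈ H)
    {a : VertexId (3 * f + 1)} {v : Vertex (3 * f + 1)} {t : ℕ}
    (hv : (run H adv ω t).sent a = some v)
    (hd : ∃ t, Delivered ((run H adv ω t).node q) a)
    (hr : ∃ t, a.1 ≤ ((run H adv ω t).node q).round)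
    (hrefs : ∀ b ∈ v.refs, ∃ t, InDag ((run H adv ω t).node q).dag b) :
    ∃ t, InDag ((run H adv ω t).node q).dag a := by
  obtain ⟨t₁, h1⟩ := hd
  obtain ⟨t₂, h2⟩ := hr
  obtain ⟨t₃, h3⟩ := exists_forall_le_of_mono
    (p := fun b t => InDag ((run H adv ω t).node q).dag b)
    (fun b t t' htt' hb => (before_run htt' q).dag.inDag hb) v.refs.toList
    (fun b hb => hrefs b (Finset.mem_toList.1 hb))
  obtain ⟨s, hs, hs1, hs2, hs3⟩ : ∃ s, t ≤ s ∧ t₁ ≤ s ∧ t₂ ≤ s ∧ t₃ ≤ s :=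
    ⟨t + t₁ + t₂ + t₃, by omega, by omega, by omega, by omega⟩
  rcases (before_run hs1 q).delivered a h1 with hb | hb
  · obtain ⟨v', hv'⟩ := Option.isSome_iff_exists.1 hb
    have hI := (invariant_run (H := H) (ω := ω) (adv := adv) s)
    obtain ⟨h4, h5, -⟩ := (hI.node q).buffer a v' hv'
    obtain rfl : v' = v := Option.some.inj (h4.symm.trans (extends_sent_run hs a v hv))
    have h6 : v'.round = a.1 := congrArg Prod.fst h5
    obtain ⟨t', ht'⟩ := hF.accept_fair q hq a v' s hv'
      ⟨by rw [h6]; exact h2.trans (before_run hs2 q).round,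
        fun b hb => (before_run hs3 q).dag.inDag (h3 b (Finset.mem_toList.2 hb))⟩
    exact ⟨t', .inr ht'⟩
  · exact ⟨s, .inr hb⟩

/-- All honest nodes add the same vertices to their DAGs, if they reach the rounds of these. -/
theorem exists_inDag_of_inDag (hF : Fair H (run H adv ω)) {p q : Node f} (hp : p ∈ H)
    (hq : q ∈ H) {a : VertexId (3 * f + 1)} {t : ℕ} (ha : InDag ((run H adv ω t).node p).dag a)
    (hr : ∃ t, a.1 ≤ ((run H adv ω t).node q).round) :
    ∃ t, InDag ((run H adv ω t).node q).dag a := by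
  induction hn : a.1 using Nat.strong_induction_on generalizing a with
  | _ n ih =>
    rcases ha with ha | ha
    · exact ⟨0, .inl ha⟩
    · have hd := hF.broadcast_agreement p hp a t (.inr ha) q hq
      obtain ⟨v, hv⟩ := Option.isSome_iff_exists.1 ha
      have hD := ((invariant_run (H := H) (ω := ω) (adv := adv) t).node p).dag
      refine exists_inDag_of_delivered hF hq (hD.ext a v hv) hd hr fun b hb => ?_
      have hlt := (hD.wellFormed a v hv).ref_lt hb
      rw [hD.round_eq hv, hn] at hlt
      refine ih b.1 hlt (hD.closed a v hv b hb) ?_ rfl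
      obtain ⟨t', ht'⟩ := hr
      exact ⟨t', by omega⟩

/-- In a fair run, all honest nodes reach all rounds. -/
theorem exists_le_round (hH : Hᶜ.card ≤ f) (hF : Fair H (run H adv ω)) (r : ℕ) :
    ∀ q ∈ H, ∃ t, r ≤ ((run H adv ω t).node q).round := by
  induction r with
  | zero => exact fun q _ => ⟨0, Nat.zero_le _⟩
  | succ r ih =>
    intro q hq
    obtain ⟨t₀, ht₀⟩ := ih q hq
    by_contra! hlt
    have hcard : 2 * f + 1 ≤ H.card := by
      have := Finset.card_add_card_compl H
      rw [Fintype.card_fin] at this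
      omega
    suffices ∃ t ≥ t₀, 2 * f + 1 ≤ (sources ((run H adv ω t).node q).dag r).card by
      obtain ⟨t, ht, hc⟩ := this
      have h1 := hlt t
      have h2 := (before_run (H := H) (adv := adv) (ω := ω) ht q).round
      have h3 : ((run H adv ω t).node q).round = r := by omega
      obtain ⟨t', ht'⟩ := hF.advance_fair q hq t (by rw [RoundComplete, h3]; exact hc)
      have := hlt t'
      omega
    rcases Nat.eq_zero_or_pos r with rfl | hr
    -- Round 0 is complete from the start, by the `2 f + 1` genesis vertices.
    · refine ⟨t₀, le_rfl, ?_⟩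
      have hs : (Finset.univ : Finset (Fin (2 * f + 1))).map (Fin.castLEEmb (by omega)) ⊆
          sources ((run H adv ω t₀).node q).dag 0 := by
        intro s hs
        obtain ⟨i, -, rfl⟩ := Finset.mem_map.1 hs
        exact mem_sources.2 (.inl ⟨rfl, i.2⟩)
      simpa using Finset.card_le_card hs
    · obtain ⟨t, ht⟩ := exists_forall_le_of_mono
        (p := fun p t => InDag ((run H adv ω t).node q).dag (r, p))
        (fun b t t' htt' hb => (before_run htt' q).dag.inDag hb) H.toList (fun p hp => by
          rw [Finset.mem_toList] at hp
          obtain ⟨t, ht⟩ := ih p hp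
          have hI := invariant_run (H := H) (ω := ω) (adv := adv) t
          have hsome := hI.own_isSome p hp r hr ht
          obtain ⟨v, hv⟩ := Option.isSome_iff_exists.1 hsome
          have hd := hF.broadcast_validity p hp r t hsome
          obtain ⟨t₁, h₁⟩ := hd q hq
          -- Well-formedness of an honest proposal is read off its delivery: only vertices that pass
          -- the checks enter a buffer.
          have hW : WellFormed v := by
            have hI' := (invariant_run (H := H) (ω := ω) (adv := adv) (max t t₁))
            have hv' := extends_sent_run (le_max_left t t₁) _ _ hv
            rcases (before_run (le_max_right t t₁) q).delivered _ h₁ with h | h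
            · obtain ⟨u, hu⟩ := Option.isSome_iff_exists.1 h
              obtain ⟨h4, -, h5⟩ := (hI'.node q).buffer _ u hu
              obtain rfl := Option.some.inj (h4.symm.trans hv')
              exact h5
            · obtain ⟨u, hu⟩ := Option.isSome_iff_exists.1 h
              obtain rfl := Option.some.inj (((hI'.node q).dag.ext _ u hu).symm.trans hv')
              exact (hI'.node q).dag.wellFormed _ _ hu
          refine exists_inDag_of_delivered hF hq hv ⟨t₁, h₁⟩ (ih q hq) fun b hb => ?_
          -- The references of an honest vertex lie in the DAG of its proposer `p`, and in lower
          -- rounds, so they reach `q` as well.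
          refine exists_inDag_of_inDag hF hp hq ((hI.own p hp r v hv).2 b hb) ⟨t₀, ?_⟩
          have h6 := hW.ref_lt hb
          have h7 : v.round = r := congrArg Prod.fst (hI.sent_id _ v hv)
          omega)
      refine ⟨max t t₀, le_max_right _ _, hcard.trans (Finset.card_le_card fun p hp => ?_)⟩
      exact mem_sources.2 ((before_run (le_max_left _ _) q).dag.inDag
        (ht p (Finset.mem_toList.2 hp)))

/-- The moment at which a node leaves a round. -/
theorem exists_leave_round {q : Node f} {r t : ℕ}
    (h : r < ((run H adv ω t).node q).round) : ∃ s < t,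
      ((run H adv ω s).node q).round = r ∧ RoundComplete ((run H adv ω s).node q) ∧
      ((run H adv ω (s + 1)).node q).log = (endRound ω ((run H adv ω s).node q)).log := by
  induction t with
  | zero => simp [run, history, initialState] at h
  | succ t ih =>
    by_cases hlt : r < ((run H adv ω t).node q).round
    · obtain ⟨s, hs, hrest⟩ := ih hlt
      exact ⟨s, by omega, hrest⟩
    · rcases (step_run (H := H) (adv := adv) (ω := ω) t).round q with he | ⟨h1, h2, h3⟩
      · omega
      · exact ⟨t, by omega, by omega, h1, h3⟩

/-- `V` is a common core of wave `w` before any honest node has completed the wave. -/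
def EarlyCore (H : Finset (Node f)) (adv : Adversary f) (w : ℕ) (ω : Coins f)
    (V : Finset (Node f)) : Prop :=
  ∃ t, (∀ p ∈ H, ((run H adv ω t).node p).round ≤ 4 * w) ∧ CommonCore (run H adv ω t).sent w V

/-- The first honest node past round `4 * w` has left this round at an earlier time `s`, when no
honest node was past it. Its DAG at `s` has a complete last round of the wave, hence contains a
core. -/
theorem exists_earlyCore (hH : Hᶜ.card ≤ f) (hF : Fair H (run H adv ω)) {w : ℕ} (hw : 1 ≤ w) :
    ∃ V, EarlyCore H adv w ω V := by
  classical
  have hne : ∃ t, ∃ p ∈ H, 4 * w < ((run H adv ω t).node p).round := by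
    obtain ⟨p, hp⟩ : H.Nonempty := by
      rw [← Finset.card_pos]
      have := Finset.card_add_card_compl H
      rw [Fintype.card_fin] at this
      omega
    obtain ⟨t, ht⟩ := exists_le_round hH hF (4 * w + 1) p hp
    exact ⟨t, p, hp, ht⟩
  obtain ⟨p, hp, hlt⟩ := Nat.find_spec hne
  obtain ⟨s, hs, h1, h2, -⟩ := exists_leave_round hlt
  have hmin := Nat.find_min hne hs
  push Not at hmin
  rw [RoundComplete, h1] at h2
  obtain ⟨V, hV⟩ :=
    ((invariant_run (H := H) (ω := ω) (adv := adv) s).node p).dag.exists_commonCore hw h2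
  exact ⟨V, s, hmin, hV⟩

/-- If the coins hit the common cores of infinitely many waves, then all honest nodes commit the
same vertices. -/
theorem exists_mem_log (hH : Hᶜ.card ≤ f) (hF : Fair H (run H adv ω))
    (hcoin : ∀ n, ∃ w > n, ∃ V, EarlyCore H adv w ω V ∧ ω w ∈ V)
    {p q : Node f} (hq : q ∈ H) {t : ℕ} {u : Vertex (3 * f + 1)}
    (hu : u ∈ ((run H adv ω t).node p).log) :
    ∃ t', u ∈ ((run H adv ω t').node q).log := by
  obtain ⟨hup, w, hcommit, hpath⟩ :=
    ((invariant_run (H := H) (ω := ω) (adv := adv) t).node p).log u hu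
  obtain ⟨w', hw', V, ⟨t₀, -, hcore⟩, hV⟩ := hcoin w
  obtain ⟨t₁, ht₁⟩ := exists_le_round hH hF (4 * w' + 1) q hq
  obtain ⟨s, -, hround, hcomplete, hlog⟩ := exists_leave_round (r := 4 * w') ht₁
  rw [RoundComplete, hround] at hcomplete
  refine ⟨s + 1, ?_⟩
  rw [hlog, endRound, hround, if_pos (by omega), Nat.mul_div_cancel_left _ (by norm_num)]
  -- One table of broadcasts, late enough to contain both DAGs and the core, which may have arisen
  -- at a third node.
  set T := (run H adv ω (t + t₀ + s)).sent with hT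
  have hDp : SoundDag T ((run H adv ω t).node p).dag :=
    ((invariant_run t).node p).dag.mono (extends_sent_run (by omega))
  have hDq : SoundDag T ((run H adv ω s).node q).dag :=
    ((invariant_run s).node q).dag.mono (extends_sent_run (by omega))
  have hcore' : CommonCore T w' V := hcore.mono (extends_sent_run (by omega))
  have hall := fun l (hl : InDag ((run H adv ω s).node q).dag (4 * w', l)) =>
    hcore'.strongPath (by omega) hDq hV hl
  obtain ⟨l, hl⟩ := Finset.card_pos.1
    (show 0 < (sources ((run H adv ω s).node q).dag (4 * w')).card by omega)
  have hlead : InDag ((run H adv ω s).node q).dag (leader ω w') := (hall l (mem_sources.1 hl)).2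
  have hstrong : StrongPath ((run H adv ω s).node q).dag (leader ω w') (leader ω w) := by
    -- As `w' > w`, the leader of wave `w'` lies beyond round `4 * w`, where every vertex reaches
    -- the leader of wave `w`.
    obtain ⟨k, hk⟩ : ∃ k, 4 * w' - 3 = 4 * w + 1 + k := ⟨4 * w' - 3 - (4 * w + 1), by omega⟩
    unfold leader at hlead ⊢
    rw [hk] at hlead ⊢
    exact hcommit.strongPath hDp hDq k _ hlead
  have hIn : InDag ((run H adv ω s).node q).dag (leader ω w) := by
    have : ∀ {D : Table f} {a b}, SoundDag T D → Path D a b → InDag D a → InDag D b :=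
      fun hD hp ha => (hD.path_transfer hD hp ha).2
    exact this hDq hstrong.path hlead
  have htrans := hDp.path_transfer hDq hpath hIn
  exact mem_completeWave_log_of_path hDq hlead hcomplete (fun l hl => (hall l hl).1)
    (hDq.eq_some htrans.2 (hDp.one_le hup) (hDp.ext _ u hup)) (hstrong.path.trans htrans.1)

theorem meetsConsistency_run {P : Primitives (3 * f + 1)} (hcid : Function.Injective P.cid)
    (hpatch : P.DiffPatchCorrect) (hH : Hᶜ.card ≤ f) (hF : Fair H (run H adv ω))
    (hcoin : ∀ n, ∃ w > n, ∃ V, EarlyCore H adv w ω V ∧ ω w ∈ V) :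
    MeetsConsistency P H (logOf (run H adv ω)) := by
  refine meetsConsistency_of_agreement hcid hpatch
    (fun p _ t t' htt' u hu => (before_run htt' p).log.subset hu)
    (fun p _ t u hu q hq => exists_mem_log hH hF hcoin hq hu) ?_
  rintro u ⟨p, -, t, hu⟩ u' ⟨q, -, t', hu'⟩ hid
  have h1 := ((invariant_run (H := H) (ω := ω) (adv := adv) t).node p)
  have h2 := ((invariant_run (H := H) (ω := ω) (adv := adv) t').node q)
  -- Both committed vertices are entries of the same table of broadcasts at a common later time.
  have h3 := extends_sent_run (le_max_left t t') _ _ (h1.dag.ext _ _ (h1.log u hu).1)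
  have h4 := extends_sent_run (le_max_right t t') _ _ (h2.dag.ext _ _ (h2.log u' hu').1)
  rw [hid] at h3
  exact Option.some.inj (h3.symm.trans h4)

/-! ### The coins -/

/-- Completing a wave moves the node to the round after its last one. If afterwards all honest nodes
are in rounds up to `4 * w`, the completed wave came before `w` and used only coins before `w`. -/
theorem apply_congr {ω ω' : Coins f} {w : ℕ} (hω : ∀ i < w, ω i = ω' i) {G : GlobalState f}
    {act : Action f} (hG : ∀ p ∈ H, ((apply H ω G act).node p).round ≤ 4 * w) :
    apply H ω G act = apply H ω' G act := by
  cases act with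
  | broadcast v => rfl
  | deliver p a => rfl
  | accept p a => rfl
  | advance p b =>
    simp only [apply] at hG ⊢
    split_ifs with h h'
    · rw [if_pos h, if_pos h'] at hG
      have h1 := hG p h.1
      simp only [setNode_node, if_true] at h1
      rw [completeWave_congr (ω := ω) (ω' := ω') fun i hi => hω i (by omega)]
    · rfl
    · rfl

/-- Until an honest node has completed wave `w`, the run depends on the earlier coins only. -/
theorem history_congr {ω ω' : Coins f} {w : ℕ} (hω : ∀ i < w, ω i = ω' i) {t : ℕ}
    (h : ∀ p ∈ H, ((run H adv ω t).node p).round ≤ 4 * w) :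
    history H adv ω t = history H adv ω' t := by
  induction t with
  | zero => rfl
  | succ t ih =>
    have h' : ∀ p ∈ H, ((run H adv ω t).node p).round ≤ 4 * w := fun p hp =>
      (before_run (Nat.le_succ t) p).round.trans (h p hp)
    -- The adversary sees the same coins in both runs: a revealed coin `i` has `4 * i < 4 * w`.
    have hrev : revealed H ω (history H adv ω t).1 = revealed H ω' (history H adv ω t).1 := by
      funext i
      unfold revealed
      split_ifs with hc
      · obtain ⟨p, hp, hlt⟩ := hc
        have h1 : 4 * i < 4 * w := hlt.trans_le (h' p hp)
        rw [hω i (by omega)]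
      · rfl
    have happ := apply_congr (H := H) hω (G := (history H adv ω t).1) h
    simp only [history, ← ih h', ← hrev, happ]

/-- The core is witnessed at a time when wave `w` is still incomplete, hence by a part of the run
that does not depend on coin `w`. -/
theorem EarlyCore.congr {ω ω' : Coins f} {w : ℕ} (hω : ∀ i < w, ω i = ω' i)
    {V : Finset (Node f)} (h : EarlyCore H adv w ω V) : EarlyCore H adv w ω' V := by
  obtain ⟨t, h1, h2⟩ := h
  have h3 : run H adv ω t = run H adv ω' t := congrArg Prod.fst (history_congr hω h1)
  exact ⟨t, h3 ▸ h1, h3 ▸ h2⟩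

end Runs

/-! ### Almost surely, the coins hit infinitely many cores -/

section CoinMeasure
open MeasureTheory
open scoped ENNReal
variable {f : ℕ} {H : Finset (Node f)} {adv : Adversary f}

instance : IsProbabilityMeasure (coinMeasure f) := by
  unfold coinMeasure; infer_instance

theorem coinMeasure_cylinder (σ : Coins f) (n : ℕ) :
    coinMeasure f {ω | ∀ i < n, ω i = σ i} = ((3 * f + 1 : ℕ) : ℝ≥0∞)⁻¹ ^ n := by
  have h : {ω : Coins f | ∀ i < n, ω i = σ i} =
      Set.pi (Finset.range n : Set ℕ) fun i => {σ i} := by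
    ext ω; simp [Set.mem_pi]
  rw [h, coinMeasure, Measure.infinitePi_pi _ fun i _ => measurableSet_singleton _]
  simp

/-- If the coin of each wave `w < n` is confined to at most `k w` values, which depend on the
earlier coins, then the coins of these waves take at most `∏ k w` values. -/
theorem exists_finset_prefixes {B : ℕ → Coins f → Finset (Node f)} {k : ℕ → ℕ}
    (hB : ∀ w ω ω', (∀ i < w, ω i = ω' i) → B w ω = B w ω') (hk : ∀ w ω, (B w ω).card ≤ k w)
    (n : ℕ) : ∃ S : Finset (Coins f), S.card ≤ ∏ w ∈ Finset.range n, k w ∧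
      ∀ ω : Coins f, (∀ w < n, ω w ∈ B w ω) → ∃ σ ∈ S, ∀ i < n, ω i = σ i := by
  classical
  induction n with
  | zero => exact ⟨{fun _ => 0}, by simp, by simp⟩
  | succ n ih =>
    obtain ⟨S, hS, hcov⟩ := ih
    refine ⟨S.biUnion fun σ => (B n σ).image fun x => Function.update σ n x, ?_, fun ω hω => ?_⟩
    · rw [Finset.prod_range_succ]
      exact (Finset.card_biUnion_le_card_mul _ _ (k n) fun σ _ =>
        Finset.card_image_le.trans (hk n σ)).trans (Nat.mul_le_mul_right _ hS)
    · obtain ⟨σ, hσ, hag⟩ := hcov ω fun w hw => hω w (by omega)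
      refine ⟨Function.update σ n (ω n), Finset.mem_biUnion.2 ⟨σ, hσ,
        Finset.mem_image_of_mem _ (hB n ω σ hag ▸ hω n (by omega))⟩, fun i hi => ?_⟩
      rcases Nat.lt_succ_iff_lt_or_eq.1 hi with hi | rfl
      · rw [Function.update_of_ne (by omega), hag i hi]
      · simp

/-- A union bound over cylinders takes the place of conditional probabilities. Monotonicity and
subadditivity hold for all sets, so the event need not be shown measurable. -/
theorem coinMeasure_le {B : ℕ → Coins f → Finset (Node f)} {k : ℕ → ℕ}
    (hB : ∀ w ω ω', (∀ i < w, ω i = ω' i) → B w ω = B w ω') (hk : ∀ w ω, (B w ω).card ≤ k w)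
    (n : ℕ) : coinMeasure f {ω | ∀ w < n, ω w ∈ B w ω} ≤
      (∏ w ∈ Finset.range n, k w : ℕ) * ((3 * f + 1 : ℕ) : ℝ≥0∞)⁻¹ ^ n := by
  obtain ⟨S, hS, hcov⟩ := exists_finset_prefixes hB hk n
  calc coinMeasure f {ω | ∀ w < n, ω w ∈ B w ω}
      ≤ coinMeasure f (⋃ σ ∈ S, {ω | ∀ i < n, ω i = σ i}) := measure_mono fun ω hω => by
        simpa using hcov ω hω
    _ ≤ ∑ σ ∈ S, coinMeasure f {ω | ∀ i < n, ω i = σ i} := measure_biUnion_finset_le _ _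
    _ = S.card * ((3 * f + 1 : ℕ) : ℝ≥0∞)⁻¹ ^ n := by simp [coinMeasure_cylinder]
    _ ≤ _ := by gcongr

/-- Almost surely, the coins do not avoid, from some wave on, sets of `2 f + 1` nodes that are
chosen in dependence on the earlier coins. -/
theorem ae_exists_mem {V : ℕ → Coins f → Finset (Node f)}
    (hV : ∀ w ω ω', (∀ i < w, ω i = ω' i) → V w ω = V w ω')
    (hcard : ∀ w ω, 2 * f + 1 ≤ (V w ω).card) :
    ∀ᵐ ω ∂(coinMeasure f), ∀ n, ∃ w > n, ω w ∈ V w ω := by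
  classical
  rw [ae_all_iff]
  intro n
  -- The coins up to `n` are free, and each later one must miss its set, which leaves at most `f`
  -- values.
  set B : ℕ → Coins f → Finset (Node f) := fun w ω => if w ≤ n then Finset.univ else (V w ω)ᶜ
    with hBdef
  have hB : ∀ w ω ω', (∀ i < w, ω i = ω' i) → B w ω = B w ω' := by
    intro w ω ω' h
    simp only [hBdef, hV w ω ω' h]
  have hk : ∀ w ω, (B w ω).card ≤ if w ≤ n then 3 * f + 1 else f := by
    intro w ω
    simp only [hBdef]
    split_ifs
    · simp
    · have h1 := Finset.card_add_card_compl (V w ω)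
      rw [Fintype.card_fin] at h1
      have h2 := hcard w ω
      omega
  have hbound : ∀ m, coinMeasure f {ω | ¬ ∃ w > n, ω w ∈ V w ω} ≤
      ((f : ℝ≥0∞) * ((3 * f + 1 : ℕ) : ℝ≥0∞)⁻¹) ^ m := by
    intro m
    have h1 : {ω : Coins f | ¬ ∃ w > n, ω w ∈ V w ω} ⊆
        {ω | ∀ w < n + 1 + m, ω w ∈ B w ω} := by
      intro ω hω w _
      simp only [hBdef]
      split_ifs with hw
      · exact Finset.mem_univ _
      · exact Finset.mem_compl.2 fun hmem => hω ⟨w, by omega, hmem⟩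
    refine (measure_mono h1).trans ((coinMeasure_le hB hk _).trans_eq ?_)
    rw [Finset.prod_range_add, Finset.prod_congr rfl (g := fun _ => 3 * f + 1)
      fun w hw => if_pos (by have := Finset.mem_range.1 hw; omega),
      Finset.prod_congr rfl (g := fun _ => f) fun w _ => if_neg (by omega)]
    simp only [Finset.prod_const, Finset.card_range]
    -- The `n + 1` free coins `0, …, n` contribute a factor 1, and each of the `m` later ones a
    -- factor `f / (3 f + 1)`.
    rw [pow_add _ (n + 1) m, mul_pow, Nat.cast_mul, Nat.cast_pow, Nat.cast_pow,
      mul_mul_mul_comm, ← mul_pow, ENNReal.mul_inv_cancel (by simp) (ENNReal.natCast_ne_top _),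
      one_pow, one_mul]
  have hlt : (f : ℝ≥0∞) * ((3 * f + 1 : ℕ) : ℝ≥0∞)⁻¹ < 1 := by
    rw [← div_eq_mul_inv, ENNReal.div_lt_iff (by simp) (by simp), one_mul]
    exact_mod_cast (by omega : f < 3 * f + 1)
  exact le_antisymm (ge_of_tendsto' (ENNReal.tendsto_pow_atTop_nhds_zero_of_lt_one hlt) hbound)
    zero_le

open Classical in
/-- A common core of wave `w` of the run, if there is any before the wave is completed. -/
noncomputable def coreOf (H : Finset (Node f)) (adv : Adversary f) (w : ℕ) (ω : Coins f) :
    Finset (Node f) :=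
  if h : ∃ V, EarlyCore H adv w ω V then h.choose else Finset.univ

/-- The choice depends on the predicate `EarlyCore H adv w ω` alone, so equality of these predicates
gives the same chosen core. -/
theorem coreOf_congr {w : ℕ} {ω ω' : Coins f} (h : ∀ i < w, ω i = ω' i) :
    coreOf H adv w ω = coreOf H adv w ω' := by
  have : EarlyCore H adv w ω = EarlyCore H adv w ω' := by
    funext V
    exact propext ⟨fun hV => hV.congr h, fun hV => hV.congr fun i hi => (h i hi).symm⟩
  unfold coreOf
  rw [this]

/-- The default `Finset.univ` secures the bound also for coins without an early core, as in unfair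
runs; `ae_exists_mem` needs it for all coins. -/
theorem le_card_coreOf (w : ℕ) (ω : Coins f) : 2 * f + 1 ≤ (coreOf H adv w ω).card := by
  unfold coreOf
  split_ifs with h
  · obtain ⟨t, -, hc⟩ := h.choose_spec
    exact hc.1
  · simp; omega

theorem earlyCore_coreOf {w : ℕ} {ω : Coins f} (h : ∃ V, EarlyCore H adv w ω V) :
    EarlyCore H adv w ω (coreOf H adv w ω) := by
  rw [coreOf, dif_pos h]
  exact h.choose_spec

end CoinMeasure

end FileDAG

/-- FileDAG meets consistency of multi-version DSN: over every ledger that realizes Byzantine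
atomic broadcast, and, almost surely, over the two-layer ledger built by DAG-Rider. -/
theorem theorem1 (f : ℕ) (P : Primitives (3 * f + 1)) (hcid : Function.Injective P.cid)
    (hpatch : P.DiffPatchCorrect) (H : Finset (Node f)) (hH : Hᶜ.card ≤ f) :
    (∀ (proposed : Node f → Vertex (3 * f + 1) → Prop)
        (log : Node f → ℕ → List (Vertex (3 * f + 1))),
      ByzantineAtomicBroadcast H proposed log → MeetsConsistency P H log) ∧
    (∀ adv : Adversary f, ∀ᵐ ω ∂(coinMeasure f),
      Fair H (run H adv ω) → MeetsConsistency P H (logOf (run H adv ω))) := by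
  refine ⟨fun _ _ h => h.meetsConsistency hcid hpatch, fun adv => ?_⟩
  -- The almost sure event concerns the coins and `coreOf` only. Fairness is used afterwards, to see
  -- that the chosen sets are genuine cores.
  filter_upwards [ae_exists_mem (V := coreOf H adv) (fun _ _ _ => coreOf_congr) le_card_coreOf]
    with ω hω hF
  refine meetsConsistency_run hcid hpatch hH hF fun n => ?_
  obtain ⟨w, hw, hmem⟩ := hω n
  exact ⟨w, hw, _, earlyCore_coreOf (exists_earlyCore hH hF (by omega)), hmem⟩
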